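/- Let $\mathcal H_A,\mathcal H_B$ be separable complex Hilbert spaces (of finite or infinite dimension), let $\mathfrak B(\mathcal H)$ and $\mathfrak T(\mathcal H)$ denote the bounded and the trace-class operators on $\mathcal H$, and let $\Phi:\mathfrak T(\mathcal H_A)\to\mathfrak T(\mathcal H_B)$ be a quantum channel, i.e. a completely positive trace-preserving linear map. Let $\Phi(\rho)=\mathrm{Tr}_{\mathcal H_E}V\rho V^*$ be a Stinespring representation of $\Phi$, where $\mathcal H_E$ is a separable Hilbert space and $V:\mathcal H_A\to\mathcal H_B\otimes\mathcal H_E$ is an isometry; let $\widehat\Phi(\rho)=\mathrm{Tr}_{\mathcal H_B}V\rho V^*$, $\widehat\Phi:\mathfrak T(\mathcal H_A)\to\mathfrak T(\mathcal H_E)$, be the complementary channel, $\widehat\Phi^*:\mathfrak B(\mathcal H_E)\to\mathfrak B(\mathcal H_A)$ its dual, defined by $\mathrm{Tr}\,\widehat\Phi(\rho)X=\mathrm{Tr}\,\rho\,\widehat\Phi^*(X)$, and let $\mathcal G(\Phi)=\widehat\Phi^*(\mathfrak B(\mathcal H_E))\subseteq\mathfrak B(\mathcal H_A)$ be the noncommutative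 graph of $\Phi$. Write $[\mathcal G(\Phi)]'$ for its commutant in $\mathfrak B(\mathcal H_A)$. A state is a positive trace-class operator with unit trace, and its support is the orthogonal complement of its kernel. The one-shot zero-error classical capacity $\bar C_0(\Phi)$ is the supremum of $\log\sharp(S)$ over all families $S$ of states on $\mathcal H_A$ such that $\mathrm{supp}\,\Phi(\rho)\perp\mathrm{supp}\,\Phi(\sigma)$ for all distinct members $\rho,\sigma$ of $S$. The one-shot zero-error quantum capacity $\bar Q_0(\Phi)$ is the supremum of $\log\dim\mathcal H_0$ over all closed subspaces $\mathcal H_0\subseteq\mathcal H_A$ for which there is a channel $\Psi:\mathfrak T(\mathcal H_B)\to\mathfrak T(\mathcal H_A)$ with $\Psi(\Phi(\rho))=\rho$ for all states $\rho$ supported by $\mathcal H_0$. The value $+\infty$ is allowed for both (and $\log 0=-\infty$). Then: 1. if $[\mathcal G(\Phi)]'$ is nontrivial, that is $[\mathcal G(\Phi)]'\neq\{\lambda I:\lambda\in\mathbb C\}$, then $\bar C_0(\Phi)>0$; 2. if $[\mathcal G(\Phi)]'$ is noncommutative, then $\bar Q_0(\Phi)>0$; 3. if $\mathcal G(\Phi)$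 is an algebra, then $[\mathcal G(\Phi)]'$ is nontrivial if and only if $\bar C_0(\Phi)>0$, and $[\mathcal G(\Phi)]'$ is noncommutative if and only if $\bar Q_0(\Phi)>0$. -/

import Mathlib

noncomputable section

namespace ZeroError

open scoped TensorProduct ComplexOrder

/-! ### Trace-class operators and the trace -/

section TraceClass

variable {H : Type*} [NormedAddCommGroup H] [InnerProductSpace ℂ H] [CompleteSpace H]
variable {K : Type*} [NormedAddCommGroup K] [InnerProductSpace ℂ K] [CompleteSpace K]

/-- `T` is of trace class (equivalently on a Hilbert space: nuclear) if it is an absolutely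
convergent sum `∑ₙ |xₙ⟩⟨yₙ|` of rank-one operators, `∑ₙ ‖xₙ‖ ‖yₙ‖ < ∞`. -/
def IsTraceClass (T : H →L[ℂ] H) : Prop :=
  ∃ x y : ℕ → H, Summable (fun n => ‖x n‖ * ‖y n‖) ∧
    HasSum (fun n => InnerProductSpace.rankOne ℂ (x n) (y n)) T

/-- Any index type may be used in the nuclear representation. -/
lemma isTraceClass_of_hasSum {ι : Type*} {T : H →L[ℂ] H} {x y : ι → H}
    (hs : Summable (fun i => ‖x i‖ * ‖y i‖))
    (hT : HasSum (fun i => InnerProductSpace.rankOne ℂ (x i) (y i)) T) : IsTraceClass T := by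
  classical
  set S : Set ι := Function.support (fun i => ‖x i‖ * ‖y i‖) with hS
  have hc : S.Countable := hs.countable_support
  have : Countable S := hc.to_subtype
  obtain ⟨f, hf⟩ := exists_injective_nat S
  have hT' : HasSum (fun i : S => InnerProductSpace.rankOne ℂ (x i) (y i)) T := by
    refine (hasSum_subtype_iff_of_support_subset (s := S) ?_).2 hT
    intro i hi
    rw [hS, Function.mem_support, ← InnerProductSpace.norm_rankOne (𝕜 := ℂ)]
    exact norm_ne_zero_iff.2 hi
  have hs' : Summable (fun i : S => ‖x i‖ * ‖y i‖) := hs.subtype S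
  refine ⟨Function.extend f (fun i : S => x i) 0, Function.extend f (fun i : S => y i) 0, ?_, ?_⟩
  · refine (hf.summable_iff ?_).1 ?_
    · intro n hn
      rw [Function.extend_apply' _ _ _ hn]
      simp
    · convert hs' using 2 with i
      simp [hf.extend_apply]
  · refine (hf.hasSum_iff ?_).1 ?_
    · intro n hn
      rw [Function.extend_apply' _ _ _ hn]
      simp
    · convert hT' using 2 with i
      simp [hf.extend_apply]

/-- The space `𝔗(H)` of trace-class operators. -/
def traceClass (H : Type*) [NormedAddCommGroup H] [InnerProductSpace ℂ H] [CompleteSpace H] :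
    Submodule ℂ (H →L[ℂ] H) where
  carrier := {T | IsTraceClass T}
  zero_mem' := ⟨0, 0, by simp, by simp⟩
  add_mem' := by
    rintro S T ⟨x, y, hs, hS⟩ ⟨x', y', hs', hT⟩
    refine isTraceClass_of_hasSum (ι := ℕ ⊕ ℕ) (x := Sum.elim x x') (y := Sum.elim y y') ?_ ?_
    · exact Summable.sum _ (by simpa [Function.comp_def] using hs)
        (by simpa [Function.comp_def] using hs')
    · exact HasSum.sum (by simpa [Function.comp_def] using hS)
        (by simpa [Function.comp_def] using hT)
  smul_mem' := by
    rintro c T ⟨x, y, hs, hT⟩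
    refine ⟨fun n => c • x n, y, ?_, ?_⟩
    · simpa [norm_smul, mul_assoc] using hs.mul_left ‖c‖
    · simpa using hT.const_smul c

/-- The index set of a fixed orthonormal basis of `H`. -/
abbrev basisIndex (H : Type*) [NormedAddCommGroup H] [InnerProductSpace ℂ H] [CompleteSpace H] :
    Set H :=
  (exists_hilbertBasis ℂ H).choose

/-- A fixed orthonormal basis of `H`. -/
def basis (H : Type*) [NormedAddCommGroup H] [InnerProductSpace ℂ H] [CompleteSpace H] :
    HilbertBasis (basisIndex H) ℂ H :=
  (exists_hilbertBasis ℂ H).choose_spec.choose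

/-- The trace `∑ᵢ ⟨eᵢ, T eᵢ⟩` over an orthonormal basis. (For trace-class `T` the series converges
absolutely and does not depend on the basis.) -/
def trace (T : H →L[ℂ] H) : ℂ :=
  ∑' i, inner ℂ (basis H i) (T (basis H i))

/-- `V T V*` is of trace class if `T` is. -/
lemma isTraceClass_conj (V : H →L[ℂ] K) {T : H →L[ℂ] H} (hT : IsTraceClass T) :
    IsTraceClass (V ∘L T ∘L ContinuousLinearMap.adjoint V) := by
  obtain ⟨x, y, hs, hT⟩ := hT
  refine ⟨fun n => V (x n), fun n => V (y n), ?_, ?_⟩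
  · refine Summable.of_nonneg_of_le (fun n => by positivity) (fun n => ?_)
      (hs.mul_left (‖V‖ * ‖V‖))
    calc ‖V (x n)‖ * ‖V (y n)‖ ≤ (‖V‖ * ‖x n‖) * (‖V‖ * ‖y n‖) := by
          gcongr <;> exact V.le_opNorm _
      _ = _ := by ring
  · have h1 : HasSum (fun n => V ∘L InnerProductSpace.rankOne ℂ (x n) (y n) ∘L
        ContinuousLinearMap.adjoint V) (V ∘L T ∘L ContinuousLinearMap.adjoint V) :=
      (ContinuousLinearMap.compL ℂ K H K V).hasSum
        (((ContinuousLinearMap.compL ℂ K H H).flip (ContinuousLinearMap.adjoint V)).hasSum hT)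
    convert h1 using 2 with n
    ext z
    simp [ContinuousLinearMap.adjoint_inner_right]

/-- The map `ρ ↦ V ρ V*` on trace-class operators. -/
def conj (V : H →L[ℂ] K) : traceClass H →ₗ[ℂ] traceClass K where
  toFun ρ := ⟨V ∘L (ρ : H →L[ℂ] H) ∘L ContinuousLinearMap.adjoint V, isTraceClass_conj V ρ.2⟩
  map_add' ρ σ := by ext z; simp
  map_smul' c ρ := by ext z; simp

end TraceClass

/-! ### Hilbert space tensor products and partial traces -/

section PartialTrace

variable {H : Type*} [NormedAddCommGroup H] [InnerProductSpace ℂ H] [CompleteSpace H]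
variable {K : Type*} [NormedAddCommGroup K] [InnerProductSpace ℂ K] [CompleteSpace K]
variable {ι : Type*}

/-- The `Jᵢ : H → K` are isometries with mutually orthogonal ranges. -/
structure OrthogonalIsometries (J : ι → H →L[ℂ] K) : Prop where
  isometry : ∀ i x y, inner ℂ (J i x) (J i y) = inner ℂ x y
  orthogonal : ∀ i j, i ≠ j → ∀ x y, inner ℂ (J i x) (J j y) = 0

lemma sum_norm_sq_le {J : ι → H →L[ℂ] K}
    (hJ : OrthogonalIsometries J)
    (z : K) (s : Finset ι) :
    ∑ i ∈ s, ‖ContinuousLinearMap.adjoint (J i) z‖ ^ 2 ≤ ‖z‖ ^ 2 := by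
  classical
  set w : K := ∑ i ∈ s, J i (ContinuousLinearMap.adjoint (J i) z) with hw
  set r : ℝ := ∑ i ∈ s, ‖ContinuousLinearMap.adjoint (J i) z‖ ^ 2 with hr
  have h1 : inner ℂ z w = (r : ℂ) := by
    simp only [hw, hr, inner_sum]
    push_cast
    refine Finset.sum_congr rfl fun i _ => ?_
    rw [← ContinuousLinearMap.adjoint_inner_left]
    exact inner_self_eq_norm_sq_to_K _
  have h2 : inner ℂ w w = (r : ℂ) := by
    rw [← h1]
    conv_lhs => rw [hw]
    conv_rhs => rw [hw]
    simp only [inner_sum, sum_inner]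
    refine Finset.sum_congr rfl fun i hi => ?_
    rw [Finset.sum_eq_single_of_mem i hi (fun j _ hj => hJ.orthogonal j i hj _ _), hJ.isometry,
      ContinuousLinearMap.adjoint_inner_left]
  have h3 : ‖w‖ ^ 2 = r := by
    have := inner_self_eq_norm_sq_to_K (𝕜 := ℂ) w
    rw [h2] at this
    exact Complex.ofReal_injective (by push_cast; exact this.symm)
  have h4 : r ≤ ‖z‖ * ‖w‖ := by
    have := norm_inner_le_norm (𝕜 := ℂ) z w
    rw [h1, Complex.norm_real] at this
    exact (le_abs_self r).trans this
  nlinarith [norm_nonneg z, norm_nonneg w, sq_nonneg (‖z‖ - ‖w‖)]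

/-- Absolute convergence of `∑_{i,n} Jᵢ* |xₙ⟩⟨yₙ| Jᵢ`. -/
lemma summable_slices {J : ι → H →L[ℂ] K}
    (hJ : OrthogonalIsometries J)
    {x y : ℕ → K} (hs : Summable (fun n => ‖x n‖ * ‖y n‖)) :
    Summable (fun p : ℕ × ι => ‖ContinuousLinearMap.adjoint (J p.2) (x p.1)‖ *
      ‖ContinuousLinearMap.adjoint (J p.2) (y p.1)‖) := by
  have key : ∀ (a b : K) (s : Finset ι), ∑ i ∈ s, ‖ContinuousLinearMap.adjoint (J i) a‖ *
      ‖ContinuousLinearMap.adjoint (J i) b‖ ≤ ‖a‖ * ‖b‖ := by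
    intro a b s
    refine (Real.sum_mul_le_sqrt_mul_sqrt s _ _).trans ?_
    gcongr
    · exact Real.sqrt_le_iff.2 ⟨norm_nonneg _, sum_norm_sq_le hJ a s⟩
    · exact Real.sqrt_le_iff.2 ⟨norm_nonneg _, sum_norm_sq_le hJ b s⟩
  refine (summable_prod_of_nonneg (fun p => by positivity)).2 ⟨fun n => ?_, ?_⟩
  · exact summable_of_sum_le (fun i => by positivity) (key (x n) (y n))
  · refine Summable.of_nonneg_of_le (fun n => tsum_nonneg fun i => by positivity) (fun n => ?_) hs
    exact Real.tsum_le_of_sum_le (fun i => by positivity) (key (x n) (y n))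

/-- `Jᵢ* T Jᵢ` -/
def slice (J : ι → H →L[ℂ] K) (T : K →L[ℂ] K) (i : ι) : H →L[ℂ] H :=
  ContinuousLinearMap.adjoint (J i) ∘L T ∘L J i

lemma hasSum_slice (J : ι → H →L[ℂ] K) {T : K →L[ℂ] K} {x y : ℕ → K}
    (hT : HasSum (fun n => InnerProductSpace.rankOne ℂ (x n) (y n)) T) (i : ι) :
    HasSum (fun n => InnerProductSpace.rankOne ℂ (ContinuousLinearMap.adjoint (J i) (x n))
      (ContinuousLinearMap.adjoint (J i) (y n))) (slice J T i) := by
  have h1 : HasSum (fun n => ContinuousLinearMap.adjoint (J i) ∘L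
      InnerProductSpace.rankOne ℂ (x n) (y n) ∘L J i) (slice J T i) :=
    (ContinuousLinearMap.compL ℂ H K H (ContinuousLinearMap.adjoint (J i))).hasSum
      (((ContinuousLinearMap.compL ℂ H K K).flip (J i)).hasSum hT)
  convert h1 using 2 with n
  ext z
  simp [ContinuousLinearMap.adjoint_inner_left]

lemma slices_aux {J : ι → H →L[ℂ] K} (hJ : OrthogonalIsometries J)
    {T : K →L[ℂ] K} (hT : IsTraceClass T) :
    Summable (slice J T) ∧ IsTraceClass (∑' i, slice J T i) := by
  obtain ⟨x, y, hs, hT⟩ := hT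
  have hsum := (Equiv.prodComm ι ℕ).summable_iff.2 (summable_slices hJ hs)
  have hFs : Summable (fun p : ι × ℕ => InnerProductSpace.rankOne ℂ
      (ContinuousLinearMap.adjoint (J p.1) (x p.2))
      (ContinuousLinearMap.adjoint (J p.1) (y p.2))) := by
    refine Summable.of_norm ?_
    simp only [InnerProductSpace.norm_rankOne]
    exact hsum
  have h2 := hFs.hasSum.prod_fiberwise (hasSum_slice J hT)
  refine ⟨h2.summable, ?_⟩
  rw [h2.tsum_eq]
  exact isTraceClass_of_hasSum hsum hFs.hasSum

/-- The map `T ↦ ∑ᵢ Jᵢ* T Jᵢ` on trace-class operators, for isometries `Jᵢ : H → K` with mutually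
orthogonal ranges. -/
def sumSlices (J : ι → H →L[ℂ] K)
    (hJ : OrthogonalIsometries J) :
    traceClass K →ₗ[ℂ] traceClass H where
  toFun T := ⟨∑' i, slice J T i, (slices_aux hJ T.2).2⟩
  map_add' S T := by
    ext1
    have h : slice J ((S + T : traceClass K) : K →L[ℂ] K) = fun i => slice J S i + slice J T i := by
      funext i; ext z; simp [slice]
    simp only [h]
    exact (slices_aux hJ S.2).1.tsum_add (slices_aux hJ T.2).1
  map_smul' c T := by
    ext1
    have h : slice J ((c • T : traceClass K) : K →L[ℂ] K) = fun i => c • slice J T i := by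
      funext i; ext z; simp [slice]
    simp only [h]
    exact (slices_aux hJ T.2).1.tsum_const_smul c

/-- The Hilbert space tensor product: the completion of the algebraic tensor product with respect
to the inner product `⟨b ⊗ e, b' ⊗ e'⟩ = ⟨b, b'⟩ ⟨e, e'⟩`. -/
abbrev HilbertTensor (B E : Type*) [NormedAddCommGroup B] [InnerProductSpace ℂ B]
    [NormedAddCommGroup E] [InnerProductSpace ℂ E] : Type _ :=
  UniformSpace.Completion (B ⊗[ℂ] E)

variable {B : Type*} [NormedAddCommGroup B] [InnerProductSpace ℂ B] [CompleteSpace B]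
variable {E : Type*} [NormedAddCommGroup E] [InnerProductSpace ℂ E] [CompleteSpace E]

/-- The operator `B → B ⊗ E`, `b ↦ b ⊗ e`. -/
def tensorRight (B : Type*) [NormedAddCommGroup B] [InnerProductSpace ℂ B] (e : E) :
    B →L[ℂ] HilbertTensor B E :=
  UniformSpace.Completion.toComplL ∘L (TensorProduct.mkL ℂ B E).flip e

/-- The operator `E → B ⊗ E`, `e ↦ b ⊗ e`. -/
def tensorLeft (E : Type*) [NormedAddCommGroup E] [InnerProductSpace ℂ E] (b : B) :
    E →L[ℂ] HilbertTensor B E :=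
  UniformSpace.Completion.toComplL ∘L TensorProduct.mkL ℂ B E b

lemma tensorRight_apply (b : B) (e : E) :
    tensorRight B e b = ((b ⊗ₜ[ℂ] e : B ⊗[ℂ] E) : HilbertTensor B E) := rfl

lemma tensorLeft_apply (b : B) (e : E) :
    tensorLeft E b e = ((b ⊗ₜ[ℂ] e : B ⊗[ℂ] E) : HilbertTensor B E) := rfl

lemma orthogonalIsometries_tensorRight :
    OrthogonalIsometries fun k => tensorRight B (basis E k) where
  isometry i x y := by
    rw [tensorRight_apply, tensorRight_apply, UniformSpace.Completion.inner_coe,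
      TensorProduct.inner_tmul, inner_self_eq_norm_sq_to_K, (basis E).orthonormal.1 i]
    simp
  orthogonal i j hij x y := by
    rw [tensorRight_apply, tensorRight_apply, UniformSpace.Completion.inner_coe,
      TensorProduct.inner_tmul, (basis E).orthonormal.2 hij, mul_zero]

lemma orthogonalIsometries_tensorLeft :
    OrthogonalIsometries fun k => tensorLeft E (basis B k) where
  isometry i x y := by
    rw [tensorLeft_apply, tensorLeft_apply, UniformSpace.Completion.inner_coe,
      TensorProduct.inner_tmul, inner_self_eq_norm_sq_to_K, (basis B).orthonormal.1 i]
    simp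
  orthogonal i j hij x y := by
    rw [tensorLeft_apply, tensorLeft_apply, UniformSpace.Completion.inner_coe,
      TensorProduct.inner_tmul, (basis B).orthonormal.2 hij, zero_mul]

/-- The partial trace `Tr_E : 𝔗(B ⊗ E) → 𝔗(B)`, that is
`⟨b, (Tr_E T) b'⟩ = ∑ₖ ⟨b ⊗ eₖ, T (b' ⊗ eₖ)⟩` for an orthonormal basis `(eₖ)` of `E`. -/
def partialTraceRight (B E : Type*) [NormedAddCommGroup B] [InnerProductSpace ℂ B]
    [CompleteSpace B] [NormedAddCommGroup E] [InnerProductSpace ℂ E] [CompleteSpace E] :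
    traceClass (HilbertTensor B E) →ₗ[ℂ] traceClass B :=
  sumSlices (fun k => tensorRight B (basis E k)) orthogonalIsometries_tensorRight

/-- The partial trace `Tr_B : 𝔗(B ⊗ E) → 𝔗(E)`, that is
`⟨e, (Tr_B T) e'⟩ = ∑ₖ ⟨bₖ ⊗ e, T (bₖ ⊗ e')⟩` for an orthonormal basis `(bₖ)` of `B`. -/
def partialTraceLeft (B E : Type*) [NormedAddCommGroup B] [InnerProductSpace ℂ B]
    [CompleteSpace B] [NormedAddCommGroup E] [InnerProductSpace ℂ E] [CompleteSpace E] :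
    traceClass (HilbertTensor B E) →ₗ[ℂ] traceClass E :=
  sumSlices (fun k => tensorLeft E (basis B k)) orthogonalIsometries_tensorLeft

end PartialTrace

/-! ### Channels, complementary channels, noncommutative graphs -/

section Channels

variable {A : Type*} [NormedAddCommGroup A] [InnerProductSpace ℂ A] [CompleteSpace A]
variable {B : Type*} [NormedAddCommGroup B] [InnerProductSpace ℂ B] [CompleteSpace B]
variable {E : Type*} [NormedAddCommGroup E] [InnerProductSpace ℂ E] [CompleteSpace E]

/-- A matrix of operators on `H` is positive as an operator on `H ⊕ ⋯ ⊕ H`. -/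
def IsPositiveMatrix {n : ℕ} (T : Fin n → Fin n → (A →L[ℂ] A)) : Prop :=
  ∀ x : Fin n → A, 0 ≤ ∑ i, ∑ j, inner ℂ (x i) (T i j (x j))

/-- Quantum channels: completely positive trace-preserving linear maps `𝔗(A) → 𝔗(B)`. -/
structure IsQuantumChannel (Φ : traceClass A →ₗ[ℂ] traceClass B) : Prop where
  completelyPositive : ∀ (n : ℕ) (T : Fin n → Fin n → traceClass A),
    IsPositiveMatrix (fun i j => (T i j : A →L[ℂ] A)) →
    IsPositiveMatrix (fun i j => (Φ (T i j) : B →L[ℂ] B))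
  tracePreserving : ∀ T : traceClass A, trace (Φ T : B →L[ℂ] B) = trace (T : A →L[ℂ] A)

/-- The channel `ρ ↦ Tr_E V ρ V*` with Stinespring isometry `V : A → B ⊗ E`. -/
def stinespringChannel (V : A →ₗᵢ[ℂ] HilbertTensor B E) : traceClass A →ₗ[ℂ] traceClass B :=
  partialTraceRight B E ∘ₗ conj V.toContinuousLinearMap

/-- `V` gives a Stinespring representation `Φ(ρ) = Tr_E V ρ V*` of `Φ`. -/
def IsStinespringRepresentation (Φ : traceClass A →ₗ[ℂ] traceClass B)
    (V : A →ₗᵢ[ℂ] HilbertTensor B E) : Prop :=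
  ∀ ρ : traceClass A, Φ ρ = stinespringChannel V ρ

/-- The complementary channel `ρ ↦ Tr_B V ρ V*`. -/
def complementaryChannel (V : A →ₗᵢ[ℂ] HilbertTensor B E) : traceClass A →ₗ[ℂ] traceClass E :=
  partialTraceLeft B E ∘ₗ conj V.toContinuousLinearMap

/-- The range `Φ*(𝔅(B))` of the dual `Φ* : 𝔅(B) → 𝔅(A)` of a channel `Φ : 𝔗(A) → 𝔗(B)`, where
`Y = Φ*(X)` means `Tr Φ(ρ) X = Tr ρ Y` for all `ρ`. -/
def dualRange (Φ : traceClass A →ₗ[ℂ] traceClass B) : Set (A →L[ℂ] A) :=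
  {Y | ∃ X : B →L[ℂ] B, ∀ ρ : traceClass A,
    trace ((Φ ρ : B →L[ℂ] B) ∘L X) = trace ((ρ : A →L[ℂ] A) ∘L Y)}

/-- The noncommutative graph of the channel with Stinespring isometry `V`: the range
of the dual of the complementary channel. -/
def noncommutativeGraph (V : A →ₗᵢ[ℂ] HilbertTensor B E) : Set (A →L[ℂ] A) :=
  dualRange (complementaryChannel V)

/-- A set of operators is an algebra. -/
def IsAlgebra (G : Set (A →L[ℂ] A)) : Prop :=
  ∃ S : Subalgebra ℂ (A →L[ℂ] A), (S : Set (A →L[ℂ] A)) = G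

/-- The commutant. -/
def commutant (G : Set (A →L[ℂ] A)) : Set (A →L[ℂ] A) :=
  {T | ∀ S ∈ G, S * T = T * S}

/-- A set of operators is noncommutative. -/
def IsNoncommutative (M : Set (A →L[ℂ] A)) : Prop :=
  ∃ S ∈ M, ∃ T ∈ M, S * T ≠ T * S

end Channels

/-! ### One-shot zero-error capacities -/

section Capacities

variable {A : Type*} [NormedAddCommGroup A] [InnerProductSpace ℂ A] [CompleteSpace A]
variable {B : Type*} [NormedAddCommGroup B] [InnerProductSpace ℂ B] [CompleteSpace B]

/-- States: positive operators with unit trace. -/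
structure IsState (ρ : traceClass A) : Prop where
  positive : (ρ : A →L[ℂ] A).IsPositive
  trace_eq_one : trace (ρ : A →L[ℂ] A) = 1

/-- The support of an operator: the orthogonal complement of its kernel. -/
def supp (T : A →L[ℂ] A) : Submodule ℂ A := (LinearMap.ker (T : A →ₗ[ℂ] A))ᗮ

/-- Families of input states whose outputs have mutually orthogonal supports. -/
def classicalCodes (Φ : traceClass A →ₗ[ℂ] traceClass B) : Set (Set (traceClass A)) :=
  {S | (∀ ρ ∈ S, IsState ρ) ∧
    S.Pairwise fun ρ σ => supp (Φ ρ : B →L[ℂ] B) ⟂ supp (Φ σ : B →L[ℂ] B)}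

/-- The one-shot zero-error classical capacity, with values in `[-∞, +∞]`
(the empty family contributes `log 0 = -∞`). -/
def classicalCapacity (Φ : traceClass A →ₗ[ℂ] traceClass B) : EReal :=
  ⨆ S ∈ classicalCodes Φ, ENNReal.log (S.encard : ENNReal)

/-- Closed subspaces on which the channel is perfectly reversible. -/
def quantumCodes (Φ : traceClass A →ₗ[ℂ] traceClass B) : Set (Submodule ℂ A) :=
  {L | IsClosed (L : Set A) ∧ ∃ Ψ : traceClass B →ₗ[ℂ] traceClass A, IsQuantumChannel Ψ ∧
    ∀ ρ : traceClass A, IsState ρ → supp (ρ : A →L[ℂ] A) ≤ L → Ψ (Φ ρ) = ρ}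

/-- The one-shot zero-error quantum capacity, with values in `[-∞, +∞]`
(the zero subspace contributes `log 0 = -∞`). -/
def quantumCapacity (Φ : traceClass A →ₗ[ℂ] traceClass B) : EReal :=
  ⨆ L ∈ quantumCodes Φ, ENNReal.log (Cardinal.toENat (Module.rank ℂ L) : ENNReal)

end Capacities

end ZeroError

end

/-! Write `W_e = (1 ⊗ ⟨e|) V` for the Kraus operators. The products `W_e* W_f` lie in the
noncommutative graph, and the graph is closed under adjoints. Everything is expressed through pairs
of vectors `x, y`. If `⟨W_e x, W_f y⟩ = 0` for all `e, f`, the outputs of the pure states `x` and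
`y` have orthogonal supports. If moreover `⟨W_e x, W_f x⟩ = ⟨W_e y, W_f y⟩` (the Knill–Laflamme
conditions) and `x, y` are orthonormal, their span can be corrected perfectly.

A non-scalar commutant contains a non-scalar self-adjoint `T`. Its spectrum has two points, and
vectors from the ranges of the positive and negative parts of `T - m`, with `m` between those
points, form an orthogonal pair that the graph does not connect (`exists_orthogonal_pair`). A
noncommutative commutant contains `a ≠ 0` with `a² = 0`; with `r = |a|`, the vectors `r w` and `a w`
satisfy both conditions (`exists_indistinguishable_pair`). The recovery channel measures matrix
units built from the partial isometry `W_e x ↦ W_e y` (`quantumCapacity_pos`).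

Conversely, let the graph be an algebra, hence a unital *-algebra. A classical code of size two
gives nonzero `x, y` with `x` orthogonal to the graph orbit of `y`; the projection onto the closure
of that orbit lies in the commutant and is not scalar. A quantum code of dimension at least two
gives the Knill–Laflamme conditions: a channel reversing a pure state must send each Kraus term of
the output to a multiple of that state (`recovery_kraus`), and comparing superpositions of `x` and
`y`, then polarizing in `e`, yields all the inner products. The orbits of `x` and `y` then have
equal Gram matrices, so `Q x ↦ Q y` defines a partial isometry in the commutant that fails to
commute with its adjoint. -/

noncomputable section

namespace ZeroError

open scoped TensorProduct ComplexOrder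
open InnerProductSpace ContinuousLinearMap

/-! ### Trace of nuclear operators: basis independence, cyclicity, pairing with bounded operators.
-/

section Trace

variable {H : Type*} [NormedAddCommGroup H] [InnerProductSpace ℂ H] [CompleteSpace H]
variable {K : Type*} [NormedAddCommGroup K] [InnerProductSpace ℂ K] [CompleteSpace K]

/-- The diagonal of a nuclear operator is summable in every orthonormal basis, with a sum that can
be read off from any nuclear representation. -/
lemma hasSum_diagonal {ι : Type*} (b : HilbertBasis ι ℂ H) {T : H →L[ℂ] H} {x y : ℕ → H}
    (hs : Summable (fun n => ‖x n‖ * ‖y n‖))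
    (hT : HasSum (fun n => rankOne ℂ (x n) (y n)) T) :
    HasSum (fun i => inner ℂ (b i) (T (b i))) (∑' n, inner ℂ (y n) (x n)) := by
  -- The basis vectors, read as isometries from `ℂ` to `H`, let `summable_slices` bound the double
  -- series. Summing it in both orders then gives the claim.
  have hJ : OrthogonalIsometries fun i => toSpanSingleton ℂ (b i) := by
    refine ⟨fun i c d => ?_, fun i j hij c d => ?_⟩
    · simp [inner_self_eq_norm_sq_to_K, b.orthonormal.1 i]
    · simp [b.orthonormal.2 hij]
  have hadj : ∀ i z, adjoint (toSpanSingleton ℂ (b i)) z = inner ℂ (b i) z := by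
    intro i z
    have := adjoint_inner_right (toSpanSingleton ℂ (b i)) 1 z
    simpa using this
  have h1 : Summable fun p : ℕ × ι => inner ℂ (b p.2) (x p.1) * inner ℂ (y p.1) (b p.2) := by
    refine Summable.of_norm ?_
    convert summable_slices hJ hs using 2 with p
    rw [norm_mul, hadj, hadj, norm_inner_symm (y p.1)]
  have h2 : ∀ n, HasSum (fun i => inner ℂ (b i) (x n) * inner ℂ (y n) (b i))
      (inner ℂ (y n) (x n)) := fun n => by
    simpa only [mul_comm] using b.hasSum_inner_mul_inner (y n) (x n)
  have h3 : ∀ i, HasSum (fun n => inner ℂ (b i) (x n) * inner ℂ (y n) (b i))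
      (inner ℂ (b i) (T (b i))) := fun i => by
    have := (innerSL ℂ (b i)).hasSum ((ContinuousLinearMap.apply ℂ H (b i)).hasSum hT)
    simpa [inner_smul_right, mul_comm] using this
  have h4 := ((Equiv.prodComm ι ℕ).summable_iff.2 h1).hasSum.prod_fiberwise h3
  have h5 := h1.hasSum.prod_fiberwise h2
  rw [h5.tsum_eq]
  simp only [Function.comp_def] at h4
  rwa [Equiv.tsum_eq (Equiv.prodComm ι ℕ)
    (fun p : ℕ × ι => inner ℂ (b p.2) (x p.1) * inner ℂ (y p.1) (b p.2))] at h4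

lemma hasSum_comp_comp (X : H →L[ℂ] K) (Y : K →L[ℂ] H) {T : H →L[ℂ] H} {x y : ℕ → H}
    (hT : HasSum (fun n => rankOne ℂ (x n) (y n)) T) :
    HasSum (fun n => rankOne ℂ (X (x n)) (adjoint Y (y n))) (X ∘L T ∘L Y) := by
  have h1 : HasSum (fun n => X ∘L rankOne ℂ (x n) (y n) ∘L Y) (X ∘L T ∘L Y) :=
    (compL ℂ K H K X).hasSum (((compL ℂ K H H).flip Y).hasSum hT)
  convert h1 using 2 with n
  ext z
  simp [adjoint_inner_left]

lemma summable_comp_comp (X : H →L[ℂ] K) (Y : K →L[ℂ] H) {x y : ℕ → H}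
    (hs : Summable (fun n => ‖x n‖ * ‖y n‖)) :
    Summable (fun n => ‖X (x n)‖ * ‖adjoint Y (y n)‖) := by
  refine Summable.of_nonneg_of_le (fun n => by positivity) (fun n => ?_)
    (hs.mul_left (‖X‖ * ‖adjoint Y‖))
  calc ‖X (x n)‖ * ‖adjoint Y (y n)‖ ≤ (‖X‖ * ‖x n‖) * (‖adjoint Y‖ * ‖y n‖) := by
        gcongr <;> exact le_opNorm _ _
    _ = _ := by ring

lemma IsTraceClass.comp_comp {T : H →L[ℂ] H} (hT : IsTraceClass T) (X : H →L[ℂ] K)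
    (Y : K →L[ℂ] H) : IsTraceClass (X ∘L T ∘L Y) := by
  obtain ⟨x, y, hs, hT⟩ := hT
  exact ⟨_, _, summable_comp_comp X Y hs, hasSum_comp_comp X Y hT⟩

lemma IsTraceClass.comp_right {T : H →L[ℂ] H} (hT : IsTraceClass T) (Y : H →L[ℂ] H) :
    IsTraceClass (T ∘L Y) :=
  hT.comp_comp (ContinuousLinearMap.id ℂ H) Y

lemma IsTraceClass.hasSum_trace {T : H →L[ℂ] H} (hT : IsTraceClass T) {ι : Type*}
    (b : HilbertBasis ι ℂ H) : HasSum (fun i => inner ℂ (b i) (T (b i))) (trace T) := by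
  obtain ⟨x, y, hs, hT⟩ := hT
  have h : trace T = ∑' n, inner ℂ (y n) (x n) := (hasSum_diagonal (basis H) hs hT).tsum_eq
  rw [h]
  exact hasSum_diagonal b hs hT

/-- Cyclicity of the trace. -/
lemma IsTraceClass.trace_comp_comp {T : H →L[ℂ] H} (hT : IsTraceClass T) (X : H →L[ℂ] K)
    (Y : K →L[ℂ] H) : trace (X ∘L T ∘L Y) = trace (T ∘L (Y ∘L X)) := by
  obtain ⟨x, y, hs, hT⟩ := hT
  have h1 : trace (X ∘L T ∘L Y) = ∑' n, inner ℂ (adjoint Y (y n)) (X (x n)) :=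
    (hasSum_diagonal (basis K) (summable_comp_comp X Y hs) (hasSum_comp_comp X Y hT)).tsum_eq
  have h2 : trace (T ∘L (Y ∘L X)) = ∑' n, inner ℂ (adjoint (Y ∘L X) (y n)) (x n) :=
    (hasSum_diagonal (basis H) (summable_comp_comp (ContinuousLinearMap.id ℂ H) _ hs)
      (hasSum_comp_comp (ContinuousLinearMap.id ℂ H) _ hT)).tsum_eq
  simp only [h1, h2, adjoint_inner_left, comp_apply]

lemma trace_zero : trace (0 : H →L[ℂ] H) = 0 := by simp [trace]

lemma IsTraceClass.trace_add {S T : H →L[ℂ] H} (hS : IsTraceClass S) (hT : IsTraceClass T) :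
    trace (S + T) = trace S + trace T := by
  have := (hS.hasSum_trace (basis H)).add (hT.hasSum_trace (basis H))
  rw [← this.tsum_eq]
  simp [trace]

lemma trace_smul (c : ℂ) (T : H →L[ℂ] H) : trace (c • T) = c * trace T := by
  simp [trace, tsum_mul_left]

lemma trace_adjoint (T : H →L[ℂ] H) : trace (adjoint T) = starRingEnd ℂ (trace T) := by
  simp only [trace, Complex.conj_tsum, inner_conj_symm, adjoint_inner_right]

lemma IsTraceClass.adjoint {T : H →L[ℂ] H} (hT : IsTraceClass T) : IsTraceClass (adjoint T) := by
  obtain ⟨x, y, hs, hT⟩ := hT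
  refine ⟨y, x, by simpa only [mul_comm] using hs, ?_⟩
  have :=
    (ContinuousLinearMap.adjoint (𝕜 := ℂ) (E := H) (F := H)).toContinuousLinearEquiv.hasSum'.2 hT
  simpa using this

lemma IsTraceClass.trace_comp_adjoint {T : H →L[ℂ] H} (hT : IsTraceClass T) (Z : H →L[ℂ] H) :
    trace (T ∘L ContinuousLinearMap.adjoint Z) =
      starRingEnd ℂ (trace (ContinuousLinearMap.adjoint T ∘L Z)) := by
  have h := hT.adjoint.trace_comp_comp Z (ContinuousLinearMap.id ℂ H)
  rw [id_comp, comp_id] at h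
  rw [← h, ← trace_adjoint, adjoint_comp, adjoint_adjoint]

lemma isTraceClass_rankOne (x y : H) : IsTraceClass (rankOne ℂ x y) :=
  isTraceClass_of_hasSum (ι := Unit) (x := fun _ => x) (y := fun _ => y)
    (Summable.of_finite) (by simp)

lemma trace_rankOne (x y : H) : trace (rankOne ℂ x y) = inner ℂ y x := by
  have := (basis H).hasSum_inner_mul_inner y x
  rw [← this.tsum_eq, trace]
  simp

lemma trace_rankOne_comp (x y : H) (X : H →L[ℂ] H) :
    trace (rankOne ℂ x y ∘L X) = inner ℂ y (X x) := by
  have h : rankOne ℂ x y ∘L X = rankOne ℂ x (adjoint X y) := by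
    ext z; simp [adjoint_inner_left]
  rw [h, trace_rankOne, adjoint_inner_left]

/-- The operator `|x⟩⟨y|` as an element of the trace class. -/
def ketBra (x y : H) : traceClass H := ⟨rankOne ℂ x y, isTraceClass_rankOne x y⟩

@[simp] lemma coe_ketBra (x y : H) : (ketBra x y : H →L[ℂ] H) = rankOne ℂ x y := rfl

lemma isState_ketBra {x : H} (hx : ‖x‖ = 1) : IsState (ketBra x x) where
  positive := isPositive_rankOne_self x
  trace_eq_one := by
    rw [coe_ketBra, trace_rankOne, inner_self_eq_norm_sq_to_K, hx]; simp

/-- `T ↦ Tr T X` as a linear functional on the trace class. -/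
def traceMul (X : H →L[ℂ] H) : traceClass H →ₗ[ℂ] ℂ where
  toFun T := trace ((T : H →L[ℂ] H) ∘L X)
  map_add' S T := by
    simp only [Submodule.coe_add, add_comp]
    exact (IsTraceClass.comp_right S.2 X).trace_add (IsTraceClass.comp_right T.2 X)
  map_smul' c T := by simp [trace_smul]

lemma traceMul_apply (X : H →L[ℂ] H) (T : traceClass H) :
    traceMul X T = trace ((T : H →L[ℂ] H) ∘L X) := rfl

lemma traceMul_add (X Y : H →L[ℂ] H) (T : traceClass H) :
    traceMul (X + Y) T = traceMul X T + traceMul Y T := by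
  simp only [traceMul_apply, comp_add]
  exact (IsTraceClass.comp_right T.2 X).trace_add (IsTraceClass.comp_right T.2 Y)

lemma traceMul_smul (c : ℂ) (X : H →L[ℂ] H) (T : traceClass H) :
    traceMul (c • X) T = c * traceMul X T := by
  simp [traceMul_apply, trace_smul]

/-- With `T = s* s` the hypothesis reads `‖s x‖² = 0`. -/
lemma eq_zero_of_isPositive_of_inner_eq_zero {T : H →L[ℂ] H} (hT : T.IsPositive) {x : H}
    (hx : inner ℂ x (T x) = 0) : T x = 0 := by
  obtain ⟨s, hs⟩ := CStarAlgebra.nonneg_iff_eq_star_mul_self.1 ((nonneg_iff_isPositive T).2 hT)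
  have h : s x = 0 := by
    rw [hs, star_eq_adjoint] at hx
    change inner ℂ x (adjoint s (s x)) = 0 at hx
    rw [adjoint_inner_right] at hx
    exact inner_self_eq_zero.1 hx
  rw [hs]
  change star s (s x) = 0
  rw [h, map_zero]

/-- A positive trace-class operator of the form `X T X*` with vanishing trace satisfies
`T X* = 0`. -/
lemma comp_adjoint_eq_zero_of_trace_eq_zero {T : H →L[ℂ] H} (hT : IsTraceClass T)
    (hpos : T.IsPositive) (X : H →L[ℂ] K) (h0 : trace (X ∘L T ∘L adjoint X) = 0) :
    T ∘L adjoint X = 0 := by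
  have hsum := (hT.comp_comp X (adjoint X)).hasSum_trace (basis K)
  rw [h0] at hsum
  have hdiag : ∀ i, T (adjoint X (basis K i)) = 0 := by
    intro i
    have hnn : ∀ i, 0 ≤ inner ℂ (basis K i) ((X ∘L T ∘L adjoint X) (basis K i)) := fun i => by
      simp only [comp_apply]
      rw [← adjoint_inner_left]
      exact hpos.inner_nonneg_right _
    -- A series of nonnegative diagonal entries with sum zero vanishes term by term.
    have h := (hasSum_zero_iff_of_nonneg hnn).1 hsum
    refine eq_zero_of_isPositive_of_inner_eq_zero hpos ?_
    rw [adjoint_inner_left]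
    exact congrFun h i
  refine ContinuousLinearMap.ext_on (s := Set.range (basis K)) ?_ ?_
  · have := (basis K).dense_span
    rw [Submodule.dense_iff_topologicalClosure_eq_top]
    exact this
  · rintro _ ⟨i, rfl⟩
    simpa using hdiag i

end Trace

/-! ### Kraus operators, and how they determine the channel, its complement and the graph. -/

section Kraus

variable {A : Type*} [NormedAddCommGroup A] [InnerProductSpace ℂ A] [CompleteSpace A]
variable {B : Type*} [NormedAddCommGroup B] [InnerProductSpace ℂ B] [CompleteSpace B]
variable {E : Type*} [NormedAddCommGroup E] [InnerProductSpace ℂ E] [CompleteSpace E]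

/-- The Kraus operator `A → B` of the channel `Tr_E V · V*` belonging to `e ∈ E`. -/
def kraus (V : A →ₗᵢ[ℂ] HilbertTensor B E) (e : E) : A →L[ℂ] B :=
  adjoint (tensorRight B e) ∘L V.toContinuousLinearMap

/-- The Kraus operator `A → E` of the channel `Tr_B V · V*` belonging to `b ∈ B`. -/
def coKraus (V : A →ₗᵢ[ℂ] HilbertTensor B E) (b : B) : A →L[ℂ] E :=
  adjoint (tensorLeft E b) ∘L V.toContinuousLinearMap

variable (V : A →ₗᵢ[ℂ] HilbertTensor B E)

/-- Both sides equal `⟨b ⊗ e, V a⟩`. This duality moves statements about the output in `B` to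
statements about `E` and back. -/
lemma inner_kraus (b : B) (e : E) (a : A) :
    inner ℂ b (kraus V e a) = inner ℂ e (coKraus V b a) := by
  simp only [kraus, coKraus, comp_apply, adjoint_inner_right, tensorRight_apply, tensorLeft_apply]

lemma inner_kraus' (b : B) (e : E) (a : A) :
    inner ℂ (kraus V e a) b = inner ℂ (coKraus V b a) e := by
  rw [← inner_conj_symm, inner_kraus, inner_conj_symm]

lemma kraus_add (e f : E) : kraus V (e + f) = kraus V e + kraus V f := by
  ext a
  refine ext_inner_left ℂ fun b => ?_
  simp [inner_kraus, inner_add_right]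

lemma kraus_smul (c : ℂ) (e : E) : kraus V (c • e) = starRingEnd ℂ c • kraus V e := by
  ext a
  refine ext_inner_left ℂ fun b => ?_
  simp [inner_kraus, inner_smul_right, mul_comm]

lemma adjoint_kraus_apply (b : B) (e : E) :
    adjoint (kraus V e) b = adjoint (coKraus V b) e := by
  refine ext_inner_right ℂ fun a => ?_
  rw [adjoint_inner_left, adjoint_inner_left, inner_kraus]

lemma inner_sumSlices {H K ι : Type*} [NormedAddCommGroup H] [InnerProductSpace ℂ H]
    [CompleteSpace H] [NormedAddCommGroup K] [InnerProductSpace ℂ K] [CompleteSpace K]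
    {J : ι → H →L[ℂ] K} (hJ : OrthogonalIsometries J) (T : traceClass K) (z w : H) :
    HasSum (fun i => inner ℂ (J i z) ((T : K →L[ℂ] K) (J i w)))
      (inner ℂ z ((sumSlices J hJ T : H →L[ℂ] H) w)) := by
  have h := (innerSL ℂ z).hasSum
    ((ContinuousLinearMap.apply ℂ H w).hasSum (slices_aux hJ T.2).1.hasSum)
  have h2 : ∀ i, inner ℂ (J i z) ((T : K →L[ℂ] K) (J i w)) = inner ℂ z (slice J T i w) := by
    intro i
    simp [slice, adjoint_inner_right]
  simp only [h2]
  exact h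

/-- The slices `⟨z ⊗ e_k, V ρ V* (w ⊗ e_k)⟩` are the diagonal entries of an operator on `E`, so the
partial trace becomes one trace and no Kraus series has to be handled. -/
lemma inner_stinespringChannel (ρ : traceClass A) (z w : B) :
    inner ℂ z ((stinespringChannel V ρ : B →L[ℂ] B) w) =
      trace (coKraus V z ∘L (ρ : A →L[ℂ] A) ∘L adjoint (coKraus V w)) := by
  have h1 := (IsTraceClass.comp_comp ρ.2 (coKraus V z) (adjoint (coKraus V w))).hasSum_trace
    (basis E)
  refine (inner_sumSlices orthogonalIsometries_tensorRight
    (conj V.toContinuousLinearMap ρ) z w).unique ?_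
  convert h1 using 2 with i
  simp only [comp_apply]
  rw [← adjoint_kraus_apply, ← inner_kraus, kraus, adjoint_comp, adjoint_adjoint]
  simp [conj, adjoint_inner_right]

lemma inner_complementaryChannel (ρ : traceClass A) (e f : E) :
    inner ℂ e ((complementaryChannel V ρ : E →L[ℂ] E) f) =
      trace (kraus V e ∘L (ρ : A →L[ℂ] A) ∘L adjoint (kraus V f)) := by
  have h1 := (IsTraceClass.comp_comp ρ.2 (kraus V e) (adjoint (kraus V f))).hasSum_trace
    (basis B)
  refine (inner_sumSlices orthogonalIsometries_tensorLeft
    (conj V.toContinuousLinearMap ρ) e f).unique ?_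
  convert h1 using 2 with i
  simp only [comp_apply]
  rw [adjoint_kraus_apply, inner_kraus, coKraus, adjoint_comp, adjoint_adjoint]
  simp [conj, adjoint_inner_right]

lemma inner_stinespringChannel_ketBra (x y : A) (z w : B) :
    inner ℂ z ((stinespringChannel V (ketBra x y) : B →L[ℂ] B) w) =
      inner ℂ (coKraus V w y) (coKraus V z x) := by
  rw [inner_stinespringChannel, coe_ketBra, IsTraceClass.trace_comp_comp (isTraceClass_rankOne x y),
    trace_rankOne_comp, comp_apply, adjoint_inner_right]

lemma inner_complementaryChannel_ketBra (x y : A) (e f : E) :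
    inner ℂ e ((complementaryChannel V (ketBra x y) : E →L[ℂ] E) f) =
      inner ℂ (kraus V f y) (kraus V e x) := by
  rw [inner_complementaryChannel, coe_ketBra,
    IsTraceClass.trace_comp_comp (isTraceClass_rankOne x y),
    trace_rankOne_comp, comp_apply, adjoint_inner_right]

/-- `Wₑ* W_f` belongs to the noncommutative graph. -/
lemma adjoint_kraus_comp_kraus_mem (e f : E) :
    adjoint (kraus V e) ∘L kraus V f ∈ noncommutativeGraph V := by
  refine ⟨rankOne ℂ e f, fun ρ => ?_⟩
  rw [← IsTraceClass.trace_comp_comp ρ.2 (kraus V f) (adjoint (kraus V e)),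
    ← inner_complementaryChannel, comp_rankOne, trace_rankOne]

lemma complementaryChannel_adjoint (ρ σ : traceClass A)
    (h : (σ : A →L[ℂ] A) = adjoint (ρ : A →L[ℂ] A)) :
    (complementaryChannel V σ : E →L[ℂ] E) = adjoint (complementaryChannel V ρ : E →L[ℂ] E) := by
  ext f
  refine ext_inner_left ℂ fun e => ?_
  rw [adjoint_inner_right, ← inner_conj_symm _ f, inner_complementaryChannel,
    inner_complementaryChannel, ← trace_adjoint, h]
  simp [adjoint_comp, comp_assoc]

/-- The noncommutative graph is closed under adjoints. -/
lemma adjoint_mem_noncommutativeGraph {Y : A →L[ℂ] A} (hY : Y ∈ noncommutativeGraph V) :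
    adjoint Y ∈ noncommutativeGraph V := by
  obtain ⟨X, hX⟩ := hY
  refine ⟨adjoint X, fun ρ => ?_⟩
  have h := hX ⟨_, IsTraceClass.adjoint ρ.2⟩
  rw [complementaryChannel_adjoint V ρ _ rfl] at h
  rw [IsTraceClass.trace_comp_adjoint (complementaryChannel V ρ).2, h,
    IsTraceClass.trace_comp_adjoint ρ.2]

/-- If all Kraus operators map `x` and `y` to orthogonal vectors, then so does the graph. -/
lemma inner_graph_eq_zero {x y : A}
    (h : ∀ e f, inner ℂ (kraus V e x) (kraus V f y) = 0) {S : A →L[ℂ] A}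
    (hS : S ∈ noncommutativeGraph V) : inner ℂ x (S y) = 0 := by
  obtain ⟨X, hX⟩ := hS
  have h0 : (complementaryChannel V (ketBra y x) : E →L[ℂ] E) = 0 := by
    ext f
    refine ext_inner_left ℂ fun e => ?_
    rw [inner_complementaryChannel_ketBra, h]
    simp
  have h1 := hX (ketBra y x)
  rw [h0, zero_comp, trace_zero, coe_ketBra, trace_rankOne_comp] at h1
  exact h1.symm

/-- Under the hypothesis the complementary channel has the same output on `|x⟩⟨x|` and `|y⟩⟨y|`, so
no element of the range of its dual separates them. -/
lemma inner_graph_eq {x y : A}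
    (h : ∀ e f, inner ℂ (kraus V e x) (kraus V f x) = inner ℂ (kraus V e y) (kraus V f y))
    {S : A →L[ℂ] A} (hS : S ∈ noncommutativeGraph V) : inner ℂ x (S x) = inner ℂ y (S y) := by
  obtain ⟨X, hX⟩ := hS
  have h0 : (complementaryChannel V (ketBra x x) : E →L[ℂ] E) =
      complementaryChannel V (ketBra y y) := by
    ext f
    refine ext_inner_left ℂ fun e => ?_
    rw [inner_complementaryChannel_ketBra, inner_complementaryChannel_ketBra, h]
  have h1 := hX (ketBra x x)
  have h2 := hX (ketBra y y)
  rw [h0, h2, coe_ketBra, trace_rankOne_comp, coe_ketBra, trace_rankOne_comp] at h1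
  exact h1.symm

/-- The support of `Φ(|x⟩⟨x|)` is contained in the closed span of the vectors `Wₑ x`. -/
lemma supp_stinespringChannel_ketBra_le (x : A) :
    supp (stinespringChannel V (ketBra x x) : B →L[ℂ] B) ≤
      (Submodule.span ℂ (Set.range fun e => kraus V e x))ᗮᗮ := by
  refine Submodule.orthogonal_le fun z hz => ?_
  have h0 : coKraus V z x = 0 := by
    refine ext_inner_left ℂ fun e => ?_
    rw [← inner_kraus, inner_zero_right]
    have he : kraus V e x ∈ Submodule.span ℂ (Set.range fun e => kraus V e x) :=
      Submodule.subset_span ⟨e, rfl⟩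
    exact Submodule.inner_left_of_mem_orthogonal he hz
  rw [LinearMap.mem_ker]
  refine ext_inner_left ℂ fun w => ?_
  rw [inner_zero_right, coe_coe, inner_stinespringChannel_ketBra, h0, inner_zero_left]

/-- The operators `Wₑ` map the range of a state `ρ` into the support of `Φ(ρ)`. -/
lemma kraus_mem_supp {ρ : traceClass A} (hρ : IsState ρ) (e : E) (a : A) :
    kraus V e ((ρ : A →L[ℂ] A) a) ∈ supp (stinespringChannel V ρ : B →L[ℂ] B) := by
  intro z hz
  rw [LinearMap.mem_ker, coe_coe] at hz
  -- For `z` in the kernel, `⟨z, Φ(ρ) z⟩ = 0` is the trace of `K ρ K*` with `K = coKraus V z`. Hence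
  -- `ρ K* = 0`, and `K* e = W_e* z`.
  have h1 := inner_stinespringChannel V ρ z z
  rw [hz, inner_zero_right] at h1
  have h2 := comp_adjoint_eq_zero_of_trace_eq_zero ρ.2 hρ.positive _ h1.symm
  have h3 : (ρ : A →L[ℂ] A) (adjoint (kraus V e) z) = 0 := by
    rw [adjoint_kraus_apply]
    exact congrArg (fun T : E →L[ℂ] A => T e) h2
  rw [← adjoint_inner_left, ← adjoint_inner_left, hρ.positive.isSelfAdjoint.adjoint_eq, h3,
    inner_zero_left]

end Kraus

/-! ### Partial isometries between families with equal Gram matrices. -/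

section PartialIsometry

variable {H : Type*} [NormedAddCommGroup H] [InnerProductSpace ℂ H] [CompleteSpace H]
variable {K : Type*} [NormedAddCommGroup K] [InnerProductSpace ℂ K]

/-- Operators that agree on a family of vectors and on its orthogonal complement are equal. -/
lemma ext_of_orthogonal {J : Type*} (f : J → H) {S T : H →L[ℂ] K} (h : ∀ i, S (f i) = T (f i))
    (h' : ∀ z, (∀ i, inner ℂ (f i) z = 0) → S z = T z) : S = T := by
  set N := (Submodule.span ℂ (Set.range f)).topologicalClosure with hN
  have hle : N ≤ LinearMap.ker ((S - T : H →L[ℂ] K) : H →ₗ[ℂ] K) := by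
    refine Submodule.topologicalClosure_minimal _ ?_ (S - T).isClosed_ker
    rw [Submodule.span_le]
    rintro _ ⟨i, rfl⟩
    simp [h i]
  ext z
  obtain ⟨a, ha, b, hb, rfl⟩ := N.exists_add_mem_mem_orthogonal z
  have h1 : S a = T a := by
    have := hle ha
    simpa [sub_eq_zero] using this
  have h2 : S b = T b := h' b fun i => Submodule.inner_right_of_mem_orthogonal
    (K := N) (Submodule.le_topologicalClosure _ (Submodule.subset_span ⟨i, rfl⟩)) hb
  rw [map_add, map_add, h1, h2]

/-- Two families with the same Gram matrix are related by a partial isometry vanishing on the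
orthogonal complement of the first family. -/
lemma exists_partialIsometry {J : Type*} (f g : J → H)
    (h : ∀ i j, inner ℂ (f i) (f j) = inner ℂ (g i) (g j)) :
    ∃ v : H →L[ℂ] H, (∀ i, v (f i) = g i) ∧ ∀ z, (∀ i, inner ℂ (f i) z = 0) → v z = 0 := by
  set N := (Submodule.span ℂ (Set.range f)).topologicalClosure with hN
  have hmem : ∀ c, Finsupp.linearCombination ℂ f c ∈ N := fun c =>
    Submodule.le_topologicalClosure _ (by
      rw [← Finsupp.range_linearCombination]; exact LinearMap.mem_range_self _ c)
  set e : (J →₀ ℂ) →ₗ[ℂ] N := (Finsupp.linearCombination ℂ f).codRestrict N hmem with he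
  -- Equal Gram matrices make combinations of `f` and `g` with the same coefficients equally long,
  -- so `f i ↦ g i` extends by continuity to the closed span `N`.
  have hnorm : ∀ c, ‖Finsupp.linearCombination ℂ g c‖ ≤ 1 * ‖e c‖ := by
    intro c
    have h1 : inner ℂ (Finsupp.linearCombination ℂ g c) (Finsupp.linearCombination ℂ g c) =
        inner ℂ (Finsupp.linearCombination ℂ f c) (Finsupp.linearCombination ℂ f c) := by
      simp only [Finsupp.linearCombination_apply, Finsupp.sum, sum_inner, inner_sum,
        inner_smul_left, inner_smul_right, h]
    rw [one_mul]
    change _ ≤ ‖Finsupp.linearCombination ℂ f c‖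
    rw [inner_self_eq_norm_sq_to_K, inner_self_eq_norm_sq_to_K] at h1
    have h2 : ‖Finsupp.linearCombination ℂ g c‖ ^ 2 = ‖Finsupp.linearCombination ℂ f c‖ ^ 2 := by
      exact_mod_cast h1
    exact ((pow_left_inj₀ (norm_nonneg _) (norm_nonneg _) two_ne_zero).1 h2).le
  have hdense : DenseRange e := by
    intro ⟨z, hz⟩
    rw [mem_closure_iff_seq_limit]
    rw [hN, ← SetLike.mem_coe, Submodule.topologicalClosure_coe, mem_closure_iff_seq_limit] at hz
    obtain ⟨u, hu, hlim⟩ := hz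
    have : ∀ n, ∃ c, Finsupp.linearCombination ℂ f c = u n := fun n => by
      have := hu n
      rwa [SetLike.mem_coe, ← Finsupp.range_linearCombination] at this
    choose c hc using this
    refine ⟨fun n => e (c n), fun n => ⟨_, rfl⟩, ?_⟩
    rw [tendsto_subtype_rng]
    simpa [he, hc] using hlim
  refine ⟨(Finsupp.linearCombination ℂ g).extendOfNorm e ∘L N.orthogonalProjectionOnto,
    fun i => ?_, fun z hz => ?_⟩
  · have h1 : N.orthogonalProjectionOnto (f i) = e (Finsupp.single i 1) := by
      have h2 : f i = (e (Finsupp.single i 1) : H) := by simp [he]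
      rw [h2, Submodule.orthogonalProjectionOnto_mem_subspace_eq_self]
    rw [comp_apply, h1, LinearMap.extendOfNorm_eq hdense ⟨1, hnorm⟩]
    simp
  · have h1 : z ∈ Nᗮ := by
      rw [hN, Submodule.orthogonal_closure]
      rw [Submodule.mem_orthogonal]
      intro u hu
      induction hu using Submodule.span_induction with
      | mem x hx => obtain ⟨i, rfl⟩ := hx; exact hz i
      | zero => simp
      | add x y _ _ hx hy => rw [inner_add_left, hx, hy, add_zero]
      | smul c x _ hx => rw [inner_smul_left, hx, mul_zero]
    rw [comp_apply, Submodule.orthogonalProjectionOnto_eq_zero_iff.2 h1,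
      map_zero]

/-- The adjoint of the partial isometry of `exists_partialIsometry`. -/
lemma adjoint_partialIsometry {J : Type*} {f g : J → H}
    (h : ∀ i j, inner ℂ (f i) (f j) = inner ℂ (g i) (g j)) {v : H →L[ℂ] H}
    (hv : ∀ i, v (f i) = g i) (hv' : ∀ z, (∀ i, inner ℂ (f i) z = 0) → v z = 0) (i : J) :
    adjoint v (g i) = f i := by
  have h1 : innerSL ℂ (g i) ∘L v = innerSL ℂ (f i) := by
    refine ext_of_orthogonal f (fun j => ?_) fun z hz => ?_
    · simp [hv, h]
    · simp [hv' z hz, hz i]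
  refine ext_inner_right ℂ fun z => ?_
  rw [adjoint_inner_left]
  exact congrArg (fun T : H →L[ℂ] ℂ => T z) h1

lemma adjoint_partialIsometry_eq_zero {J : Type*} {f g : J → H} {v : H →L[ℂ] H}
    (hv : ∀ i, v (f i) = g i) (hv' : ∀ z, (∀ i, inner ℂ (f i) z = 0) → v z = 0) {w : H}
    (hw : ∀ i, inner ℂ w (g i) = 0) : adjoint v w = 0 := by
  have h1 : innerSL ℂ w ∘L v = 0 := by
    refine ext_of_orthogonal f (fun j => ?_) fun z hz => ?_
    · simp [hv, hw]
    · simp [hv' z hz]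
  refine ext_inner_right ℂ fun z => ?_
  rw [adjoint_inner_left, inner_zero_left]
  exact congrArg (fun T : H →L[ℂ] ℂ => T z) h1

end PartialIsometry

/-! ### The channel that corrects the span of an orthonormal pair. -/

section Recovery

variable {A : Type*} [NormedAddCommGroup A] [InnerProductSpace ℂ A] [CompleteSpace A]
variable {B : Type*} [NormedAddCommGroup B] [InnerProductSpace ℂ B] [CompleteSpace B]
variable {E : Type*} [NormedAddCommGroup E] [InnerProductSpace ℂ E] [CompleteSpace E]

/-- The map `T ↦ ∑ᵢⱼ Tr(T Fᵢⱼ) |xᵢ⟩⟨xⱼ|` for the matrix units `F` generated by a partial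
isometry `v`. -/
def recovery (v : B →L[ℂ] B) (x y : A) : traceClass B →ₗ[ℂ] traceClass A :=
  (traceMul (1 - v ∘L adjoint v)).smulRight (ketBra x x) + (traceMul v).smulRight (ketBra x y) +
    (traceMul (adjoint v)).smulRight (ketBra y x) +
    (traceMul (v ∘L adjoint v)).smulRight (ketBra y y)

lemma recovery_apply (v : B →L[ℂ] B) (x y : A) (T : traceClass B) :
    recovery v x y T = traceMul (1 - v ∘L adjoint v) T • ketBra x x + traceMul v T • ketBra x y +
      traceMul (adjoint v) T • ketBra y x + traceMul (v ∘L adjoint v) T • ketBra y y := rfl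

lemma traceMul_one (T : traceClass A) : traceMul 1 T = trace (T : A →L[ℂ] A) := rfl

lemma traceMul_one_ketBra (x y : A) : traceMul 1 (ketBra x y) = inner ℂ y x :=
  trace_rankOne x y

lemma traceMul_one_sub (X : A →L[ℂ] A) (T : traceClass A) :
    traceMul (1 - X) T = trace (T : A →L[ℂ] A) - traceMul X T := by
  have h := traceMul_add (1 - X) X T
  rw [sub_add_cancel, traceMul_one] at h
  rw [h]
  ring

/-- Block positivity is applied to the vectors `N i b_k` and summed over the basis vectors `b_k`. -/
lemma sum_trace_nonneg {n : ℕ} {T : Fin n → Fin n → traceClass B}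
    (hT : IsPositiveMatrix (fun i j => (T i j : B →L[ℂ] B))) (N : Fin n → B →L[ℂ] B) :
    0 ≤ ∑ i, ∑ j, trace (adjoint (N i) ∘L (T i j : B →L[ℂ] B) ∘L N j) := by
  have h := hasSum_sum (s := Finset.univ) fun i _ => hasSum_sum (s := Finset.univ) fun j _ =>
    (IsTraceClass.comp_comp (T i j).2 (adjoint (N i)) (N j)).hasSum_trace (basis B)
  refine h.nonneg fun k => ?_
  simpa [adjoint_inner_right] using hT fun i => N i (basis B k)

/-- The diagonal coefficients use `1 - v v*` and `v v*`, which add up to `1`; this gives trace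
preservation. Since `v² = 0` and `v v* v = v`, the four coefficient operators multiply as `F_i F_j*`
with `F = (1 - v v*, v)`, which gives complete positivity. -/
lemma isQuantumChannel_recovery {v : B →L[ℂ] B} {x y : A} (hx : ‖x‖ = 1) (hy : ‖y‖ = 1)
    (hxy : inner ℂ x y = 0) (hv : v ∘L v = 0) (hv' : v ∘L adjoint v ∘L v = v) :
    IsQuantumChannel (recovery v x y) where
  completelyPositive n T hT := by
    intro z
    have hva : adjoint v ∘L adjoint v = 0 := by
      rw [← adjoint_comp, hv, map_zero]
    -- Chosen so that the quadratic form of the output at `z` is `∑ Tr (N i)* (T i j) (N j)`.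
    set N : Fin n → B →L[ℂ] B := fun i =>
      (inner ℂ x (z i) : ℂ) • (1 - v ∘L adjoint v) + (inner ℂ y (z i) : ℂ) • v with hN
    convert sum_trace_nonneg hT N using 3 with i _ j _
    rw [IsTraceClass.trace_comp_comp (T i j).2]
    have h1 : N j ∘L adjoint (N i) =
        (inner ℂ (z i) x * inner ℂ x (z j) : ℂ) • (1 - v ∘L adjoint v) +
        (inner ℂ (z i) x * inner ℂ y (z j) : ℂ) • v +
        (inner ℂ (z i) y * inner ℂ x (z j) : ℂ) • adjoint v +
        (inner ℂ (z i) y * inner ℂ y (z j) : ℂ) • (v ∘L adjoint v) := by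
      have e1 : ∀ b, v (v b) = 0 := fun b => congrArg (fun T : B →L[ℂ] B => T b) hv
      have e2 : ∀ b, v (adjoint v (v b)) = v b := fun b => congrArg (fun T : B →L[ℂ] B => T b) hv'
      have e3 : ∀ b, adjoint v (adjoint v b) = 0 := fun b =>
        congrArg (fun T : B →L[ℂ] B => T b) hva
      have e4 : adjoint (1 : B →L[ℂ] B) = 1 := star_one _
      have e5 : ∀ b, (1 : B →L[ℂ] B) b = b := fun _ => rfl
      ext b
      simp only [hN, map_add, map_sub, map_smulₛₗ, adjoint_comp, adjoint_adjoint, e4, e5,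
        comp_apply, add_apply, smul_apply, sub_apply, e1, e2, e3, inner_conj_symm, smul_add, smul_sub,
        RingHom.id_apply, map_zero, smul_zero]
      module
    have h2 := traceMul_apply (N j ∘L adjoint (N i)) (T i j)
    rw [← h2, h1, traceMul_add, traceMul_add, traceMul_add, traceMul_smul, traceMul_smul,
      traceMul_smul, traceMul_smul]
    beta_reduce
    rw [recovery_apply]
    simp
    ring
  tracePreserving T := by
    have hyx : inner ℂ y x = 0 := inner_eq_zero_symm.1 hxy
    rw [← traceMul_one, recovery_apply]
    simp only [map_add, map_smul, traceMul_one_ketBra, hxy, hyx, inner_self_eq_norm_sq_to_K, hx, hy,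
      traceMul_one_sub]
    simp

variable (V : A →ₗᵢ[ℂ] HilbertTensor B E)

/-- The ket of `|x⟩⟨a|` enters the output only through the vectors `W_e x`, so an operator carrying
these to `W_e y` replaces `x` by `y`. -/
lemma comp_stinespringChannel_ketBra {v : B →L[ℂ] B} {x y : A}
    (h : ∀ e, v (kraus V e x) = kraus V e y) (a : A) :
    v ∘L (stinespringChannel V (ketBra x a) : B →L[ℂ] B) = stinespringChannel V (ketBra y a) := by
  ext w
  refine ext_inner_left ℂ fun z => ?_
  rw [comp_apply, ← adjoint_inner_left, inner_stinespringChannel_ketBra,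
    inner_stinespringChannel_ketBra]
  congr 1
  refine ext_inner_left ℂ fun e => ?_
  rw [← inner_kraus, ← inner_kraus, adjoint_inner_left, h]

lemma traceMul_stinespringChannel_ketBra {v : B →L[ℂ] B} {x y : A}
    (h : ∀ e, v (kraus V e x) = kraus V e y) (a : A) :
    traceMul v (stinespringChannel V (ketBra x a)) =
      trace (stinespringChannel V (ketBra y a) : B →L[ℂ] B) := by
  rw [traceMul_apply, ← comp_stinespringChannel_ketBra V h]
  have := IsTraceClass.trace_comp_comp (stinespringChannel V (ketBra x a)).2 v
    (ContinuousLinearMap.id ℂ B)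
  rw [comp_id, id_comp] at this
  exact this.symm

/-- On the vectors `W_e x` and `W_e y` the four measured operators act as the matrix units of the
pair `x, y`. Each coefficient is therefore the trace of `Φ` of a ket-bra, which trace preservation
evaluates. -/
lemma recovery_stinespringChannel {v : B →L[ℂ] B} {x y : A} (hx : ‖x‖ = 1) (hy : ‖y‖ = 1)
    (hxy : inner ℂ x y = 0)
    (htr : ∀ T, trace (stinespringChannel V T : B →L[ℂ] B) = trace (T : A →L[ℂ] A))
    (h1 : ∀ e, v (kraus V e x) = kraus V e y) (h2 : ∀ e, v (kraus V e y) = 0)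
    (h3 : ∀ e, adjoint v (kraus V e y) = kraus V e x) (h4 : ∀ e, adjoint v (kraus V e x) = 0)
    {ρ : traceClass A} (hρ : ρ ∈ Submodule.span ℂ
      ({ketBra x x, ketBra x y, ketBra y x, ketBra y y} : Set (traceClass A))) :
    recovery v x y (stinespringChannel V ρ) = ρ := by
  have hyx : inner ℂ y x = 0 := inner_eq_zero_symm.1 hxy
  -- Zero is written as `W_e 0` so that annihilation becomes an instance of
  -- `traceMul_stinespringChannel_ketBra`.
  have h2' : ∀ e, v (kraus V e y) = kraus V e 0 := by simpa using h2
  have h4' : ∀ e, adjoint v (kraus V e x) = kraus V e 0 := by simpa using h4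
  have h5 : ∀ e, (v ∘L adjoint v) (kraus V e x) = kraus V e 0 := by simp [h4]
  have h6 : ∀ e, (v ∘L adjoint v) (kraus V e y) = kraus V e y := by simp [h3, h1]
  have hxx : inner ℂ x x = (1 : ℂ) := by rw [inner_self_eq_norm_sq_to_K, hx]; simp
  have hyy : inner ℂ y y = (1 : ℂ) := by rw [inner_self_eq_norm_sq_to_K, hy]; simp
  induction hρ using Submodule.span_induction with
  | mem ρ hρ =>
    rcases hρ with rfl | rfl | rfl | rfl <;>
    simp only [recovery_apply, traceMul_one_sub, traceMul_stinespringChannel_ketBra V h1,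
      traceMul_stinespringChannel_ketBra V h2', traceMul_stinespringChannel_ketBra V h3,
      traceMul_stinespringChannel_ketBra V h4', traceMul_stinespringChannel_ketBra V h5,
      traceMul_stinespringChannel_ketBra V h6, htr, coe_ketBra, trace_rankOne, hxx, hyy, hxy, hyx,
      inner_zero_right] <;>
    simp
  | zero => simp
  | add ρ σ _ _ hρ hσ => rw [map_add, map_add, hρ, hσ]
  | smul c ρ _ hρ => rw [map_smul, map_smul, hρ]

/-- A state supported by the span of an orthonormal pair is a combination of its matrix units. -/
lemma mem_span_ketBra {x y : A} (hx : ‖x‖ = 1) (hy : ‖y‖ = 1) (hxy : inner ℂ x y = 0)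
    {ρ : traceClass A} (hρ : IsState ρ)
    (hsupp : supp (ρ : A →L[ℂ] A) ≤ Submodule.span ℂ {x, y}) :
    ρ ∈ Submodule.span ℂ
      ({ketBra x x, ketBra x y, ketBra y x, ketBra y y} : Set (traceClass A)) := by
  have hyx : inner ℂ y x = 0 := inner_eq_zero_symm.1 hxy
  have hxx : inner ℂ x x = (1 : ℂ) := by rw [inner_self_eq_norm_sq_to_K, hx]; simp
  have hyy : inner ℂ y y = (1 : ℂ) := by rw [inner_self_eq_norm_sq_to_K, hy]; simp
  have hsa : adjoint (ρ : A →L[ℂ] A) = ρ := hρ.positive.isSelfAdjoint.adjoint_eq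
  have hran : ∀ w, ∃ a b : ℂ, (ρ : A →L[ℂ] A) w = a • x + b • y := by
    intro w
    have h1 : (ρ : A →L[ℂ] A) w ∈ supp (ρ : A →L[ℂ] A) := by
      intro z hz
      rw [LinearMap.mem_ker, coe_coe] at hz
      rw [← adjoint_inner_left, hsa, hz, inner_zero_left]
    obtain ⟨a, b, h⟩ := Submodule.mem_span_pair.1 (hsupp h1)
    exact ⟨a, b, h.symm⟩
  -- The range lies in the span of `x, y`, and self-adjointness identifies the coordinates of `ρ w`.
  have hexp : ∀ w, (ρ : A →L[ℂ] A) w =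
      inner ℂ ((ρ : A →L[ℂ] A) x) w • x + inner ℂ ((ρ : A →L[ℂ] A) y) w • y := by
    intro w
    obtain ⟨a, b, h⟩ := hran w
    have e1 : inner ℂ ((ρ : A →L[ℂ] A) x) w = a := by
      conv_lhs => rw [← hsa]
      rw [adjoint_inner_left, h]
      simp [inner_add_right, inner_smul_right, hx, hxy]
    have e2 : inner ℂ ((ρ : A →L[ℂ] A) y) w = b := by
      conv_lhs => rw [← hsa]
      rw [adjoint_inner_left, h]
      simp [inner_add_right, inner_smul_right, hy, hyx]
    rw [e1, e2, h]
  obtain ⟨a, b, h1⟩ := hran x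
  obtain ⟨c, d, h2⟩ := hran y
  have hsum : ρ = starRingEnd ℂ a • ketBra x x + starRingEnd ℂ b • ketBra x y +
      starRingEnd ℂ c • ketBra y x + starRingEnd ℂ d • ketBra y y := by
    ext w
    rw [hexp w, h1, h2]
    simp [smul_smul]
    module
  rw [hsum]
  refine add_mem (add_mem (add_mem ?_ ?_) ?_) ?_ <;>
  exact Submodule.smul_mem _ _ (Submodule.subset_span (by simp))

end Recovery

/-! ### Commutants of self-adjoint sets: spectral calculus and square-zero elements. -/

section OperatorAlgebra

variable {H : Type*} [NormedAddCommGroup H] [InnerProductSpace ℂ H] [CompleteSpace H]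

/-- By spectral mapping, the nonzero number `f t` lies in the spectrum of `cfc f T`. -/
lemma cfc_ne_zero_of_mem_spectrum {T : H →L[ℂ] H} (hT : IsSelfAdjoint T) {f : ℝ → ℝ}
    (hf : Continuous f) {t : ℝ} (ht : t ∈ spectrum ℝ T) (hft : f t ≠ 0) : cfc f T ≠ 0 := by
  intro h0
  have h2 : f t ∈ spectrum ℝ (cfc f T) := by
    rw [cfc_map_spectrum f T hT hf.continuousOn]
    exact ⟨t, ht, rfl⟩
  have : Nontrivial (H →L[ℂ] H) := by
    by_contra hn
    rw [not_nontrivial_iff_subsingleton] at hn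
    rw [spectrum.of_subsingleton] at ht
    exact ht
  rw [h0, spectrum.zero_eq] at h2
  exact hft h2

/-- The operators `(T - m)⁺` and `(T - m)⁻`. -/
lemma exists_posPart_negPart {T : H →L[ℂ] H} (hT : IsSelfAdjoint T) (m : ℝ) :
    ∃ p q : H →L[ℂ] H, 0 ≤ p ∧ 0 ≤ q ∧ p - q = T - algebraMap ℝ _ m ∧ p * q = 0 ∧
      (∀ b, Commute T b → Commute p b ∧ Commute q b) ∧
      ((∃ t ∈ spectrum ℝ T, m < t) → p ≠ 0) ∧ ((∃ t ∈ spectrum ℝ T, t < m) → q ≠ 0) := by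
  refine ⟨cfc (fun t => max (t - m) 0) T, cfc (fun t => max (m - t) 0) T,
    cfc_nonneg fun t _ => le_max_right _ _, cfc_nonneg fun t _ => le_max_right _ _, ?_, ?_,
    fun b hb => ⟨hb.cfc_real _, hb.cfc_real _⟩, ?_, ?_⟩
  · rw [← cfc_sub _ _ T]
    have h : (fun t : ℝ => max (t - m) 0 - max (m - t) 0) = fun t => t - m := by
      funext t
      rcases le_total t m with h | h
      · rw [max_eq_right (by linarith), max_eq_left (by linarith)]; ring
      · rw [max_eq_left (by linarith), max_eq_right (by linarith)]; ring
    rw [h, cfc_sub _ _ T, cfc_id' ℝ T, cfc_const m T]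
  · rw [← cfc_mul _ _ T]
    have h : (fun t : ℝ => max (t - m) 0 * max (m - t) 0) = fun _ => 0 := by
      funext t
      rcases le_total t m with h | h
      · rw [max_eq_right (by linarith : t - m ≤ 0), zero_mul]
      · rw [max_eq_right (by linarith : m - t ≤ 0), mul_zero]
    rw [h, cfc_const_zero]
  · rintro ⟨t, ht, hm⟩
    refine cfc_ne_zero_of_mem_spectrum hT (by fun_prop) ht ?_
    rw [max_eq_left (by linarith)]
    linarith
  · rintro ⟨t, ht, hm⟩
    refine cfc_ne_zero_of_mem_spectrum hT (by fun_prop) ht ?_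
    rw [max_eq_left (by linarith)]
    linarith

lemma star_mem_centralizer {G : Set (H →L[ℂ] H)} (hG : ∀ S ∈ G, star S ∈ G) {T : H →L[ℂ] H}
    (hT : T ∈ G.centralizer) : star T ∈ G.centralizer := by
  intro S hS
  have := congrArg star (hT (star S) (hG S hS))
  simpa using this.symm

/-- A linear property of operators holds on the centralizer of a self-adjoint set if it holds for
the self-adjoint elements of the centralizer. -/
lemma centralizer_induction {G : Set (H →L[ℂ] H)} (hG : ∀ S ∈ G, star S ∈ G)
    {p : (H →L[ℂ] H) → Prop} (hadd : ∀ S T, p S → p T → p (S + T))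
    (hsmul : ∀ (c : ℂ) S, p S → p (c • S))
    (hsa : ∀ T ∈ G.centralizer, IsSelfAdjoint T → p T) {T : H →L[ℂ] H}
    (hT : T ∈ G.centralizer) : p T := by
  have hT' := star_mem_centralizer hG hT
  -- Decomposition into self-adjoint parts, with the skew part multiplied by `i`.
  have h1 : T = (2⁻¹ : ℂ) • (T + star T) + (-(2⁻¹) * Complex.I) • (Complex.I • (T - star T)) := by
    rw [smul_smul, mul_assoc, Complex.I_mul_I]
    module
  have hI : Complex.I • (T - star T) ∈ G.centralizer := by
    intro S hS
    rw [mul_smul_comm, smul_mul_assoc, mul_sub, sub_mul, hT S hS, hT' S hS]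
  rw [h1]
  refine hadd _ _ (hsmul _ _ (hsa _ (Set.add_mem_centralizer hT hT') ?_))
    (hsmul _ _ (hsa _ hI ?_))
  · rw [IsSelfAdjoint, star_add, star_star, add_comm]
  · rw [IsSelfAdjoint, star_smul, star_sub, star_star]
    simp [← smul_neg]

lemma isSelfAdjoint_inner {T : H →L[ℂ] H} (hT : IsSelfAdjoint T) (x y : H) :
    inner ℂ (T x) y = inner ℂ x (T y) := by
  rw [← adjoint_inner_right, hT.adjoint_eq]

/-- A non-scalar self-adjoint element of the centralizer has two spectral points. The parts of `T`
above and below their midpoint are nonzero, have product zero and commute with `G`, so `G` keeps the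
range of one inside itself and orthogonal to the range of the other. -/
lemma exists_orthogonal_pair {G : Set (H →L[ℂ] H)} (hG : ∀ S ∈ G, star S ∈ G)
    (h : ∃ T ∈ G.centralizer, ∀ c : ℂ, T ≠ c • 1) :
    ∃ x y : H, ‖x‖ = 1 ∧ ‖y‖ = 1 ∧ inner ℂ x y = 0 ∧ ∀ S ∈ G, inner ℂ x (S y) = 0 := by
  have h1 : ∃ T ∈ G.centralizer, IsSelfAdjoint T ∧ ∀ c : ℂ, T ≠ c • 1 := by
    by_contra! hcon
    obtain ⟨T, hT, hc⟩ := h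
    have : ∃ c : ℂ, T = c • 1 := by
      refine centralizer_induction hG (p := fun T => ∃ c : ℂ, T = c • 1) ?_ ?_ hcon hT
      · rintro _ _ ⟨c, rfl⟩ ⟨d, rfl⟩
        exact ⟨c + d, (add_smul _ _ _).symm⟩
      · rintro c _ ⟨d, rfl⟩
        exact ⟨c * d, smul_smul _ _ _⟩
    obtain ⟨c, hc'⟩ := this
    exact hc c hc'
  obtain ⟨T, hT, hsa, hc⟩ := h1
  obtain ⟨s, hs, t, ht, hst⟩ : ∃ s ∈ spectrum ℝ T, ∃ t ∈ spectrum ℝ T, s < t := by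
    by_contra! hcon
    have : ∃ c, spectrum ℝ T ⊆ {c} := by
      rcases (spectrum ℝ T).eq_empty_or_nonempty with h0 | ⟨c, hc⟩
      · exact ⟨0, by simp [h0]⟩
      · exact ⟨c, fun d hd => le_antisymm (hcon c hc d hd) (hcon d hd c hc)⟩
    obtain ⟨c, hc'⟩ := this
    refine hc c ?_
    have := CFC.eq_algebraMap_of_spectrum_subset_singleton T c hc'
    rw [this, Algebra.algebraMap_eq_smul_one]
    ext z
    simp
  obtain ⟨p, q, hp, hq, -, hpq, hcomm, hp0, hq0⟩ := exists_posPart_negPart hsa ((s + t) / 2)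
  have hp1 := hp0 ⟨t, ht, by linarith⟩
  have hq1 := hq0 ⟨s, hs, by linarith⟩
  obtain ⟨u, hu⟩ : ∃ u, p u ≠ 0 := by
    by_contra! hcon
    exact hp1 (ContinuousLinearMap.ext hcon)
  obtain ⟨w, hw⟩ : ∃ w, q w ≠ 0 := by
    by_contra! hcon
    exact hq1 (ContinuousLinearMap.ext hcon)
  have key : ∀ z, inner ℂ (p u) (q z) = 0 := by
    intro z
    rw [isSelfAdjoint_inner (IsSelfAdjoint.of_nonneg hp)]
    have : p (q z) = 0 := congrArg (fun T : H →L[ℂ] H => T z) hpq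
    rw [this, inner_zero_right]
  refine ⟨(‖p u‖⁻¹ : ℂ) • p u, (‖q w‖⁻¹ : ℂ) • q w, norm_smul_inv_norm hu, norm_smul_inv_norm hw,
    ?_, fun S hS => ?_⟩
  · rw [inner_smul_left, inner_smul_right, key, mul_zero, mul_zero]
  · have h2 : S (q w) = q (S w) := by
      have := ((hcomm S (hT S hS).symm).2).eq
      exact (congrArg (fun T : H →L[ℂ] H => T w) this).symm
    rw [inner_smul_left, map_smul, inner_smul_right, h2, key, mul_zero, mul_zero]

/-- The projection onto a subspace invariant under `Q` and its adjoint commutes with `Q`. -/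
lemma commute_starProjection (N : Submodule ℂ H) [N.HasOrthogonalProjection] {Q : H →L[ℂ] H}
    (h1 : ∀ z ∈ N, Q z ∈ N) (h2 : ∀ z ∈ N, star Q z ∈ N) : Commute N.starProjection Q := by
  have h3 : ∀ z ∈ Nᗮ, Q z ∈ Nᗮ := by
    intro z hz w hw
    rw [← adjoint_inner_left]
    exact hz _ (h2 w hw)
  ext z
  obtain ⟨a, ha, b, hb, rfl⟩ := N.exists_add_mem_mem_orthogonal z
  change N.starProjection (Q (a + b)) = Q (N.starProjection (a + b))
  rw [map_add, map_add, map_add, Submodule.starProjection_eq_self_iff.2 ha,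
    Submodule.starProjection_eq_self_iff.2 (h1 a ha),
    (Submodule.starProjection_apply_eq_zero_iff _).2 hb,
    (Submodule.starProjection_apply_eq_zero_iff _).2 (h3 b hb), map_add, map_zero]

/-- The spectral projection of `T` belonging to `(-∞, m]`. -/
lemma exists_spectralProjection {T : H →L[ℂ] H} (hT : IsSelfAdjoint T) (m : ℝ) :
    ∃ P : H →L[ℂ] H, IsStarProjection P ∧
      (∀ Q, Commute T Q → Commute T (star Q) → Commute P Q) ∧
      (∀ x, RCLike.re (inner ℂ (P x) (T (P x))) ≤ m * ‖P x‖ ^ 2) ∧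
      ∀ x, m * ‖x - P x‖ ^ 2 ≤ RCLike.re (inner ℂ (x - P x) (T (x - P x))) := by
  obtain ⟨p, q, hp, hq, hpq, hmul, hcomm, -, -⟩ := exists_posPart_negPart hT m
  -- On the kernel of `p = (T - m)⁺` we have `T ≤ m`. Since `p q = 0`, the range of `q` lies in this
  -- kernel, so `q` vanishes on the orthogonal complement and `T ≥ m` there.
  set N : Submodule ℂ H := LinearMap.ker (p : H →ₗ[ℂ] H) with hN
  have hclosed : IsClosed (N : Set H) := p.isClosed_ker
  have : CompleteSpace N := hclosed.completeSpace_coe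
  have hpsa := IsSelfAdjoint.of_nonneg hp
  have hqsa := IsSelfAdjoint.of_nonneg hq
  have hT' : ∀ z, T z = (m : ℂ) • z + p z - q z := by
    intro z
    have h1 : p z - q z = T z - (m : ℂ) • z := by
      have := congrArg (fun T : H →L[ℂ] H => T z) hpq
      rw [Algebra.algebraMap_eq_smul_one] at this
      simpa using this
    rw [add_sub_assoc, h1]
    abel
  have hinner : ∀ z, RCLike.re (inner ℂ z (T z)) =
      m * ‖z‖ ^ 2 + RCLike.re (inner ℂ z (p z)) - RCLike.re (inner ℂ z (q z)) := by
    intro z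
    rw [hT', inner_sub_right, inner_add_right, inner_smul_right, map_sub, map_add]
    congr 2
    rw [← inner_self_eq_norm_sq (𝕜 := ℂ)]
    exact Complex.re_ofReal_mul _ _
  have hmem : ∀ x, N.starProjection x ∈ N := fun x => N.starProjection_apply_mem x
  refine ⟨N.starProjection, isStarProjection_starProjection, fun Q h1 h2 => ?_, fun x => ?_,
    fun x => ?_⟩
  · refine commute_starProjection N (fun z hz => ?_) fun z hz => ?_
    · have h := congrArg (fun T : H →L[ℂ] H => T z) (hcomm Q h1).1.eq
      change p (Q z) = Q (p z) at h
      have hz' : p z = 0 := hz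
      rw [hz', map_zero] at h
      exact h
    · have h := congrArg (fun T : H →L[ℂ] H => T z) (hcomm _ h2).1.eq
      change p (star Q z) = star Q (p z) at h
      have hz' : p z = 0 := hz
      rw [hz', map_zero] at h
      exact h
  · have h1 : p (N.starProjection x) = 0 := hmem x
    have h2 := ((nonneg_iff_isPositive q).1 hq).re_inner_nonneg_right (N.starProjection x)
    rw [hinner, h1, inner_zero_right, map_zero]
    linarith
  · have h1 : q (x - N.starProjection x) = 0 := by
      refine ext_inner_right ℂ fun w => ?_
      rw [isSelfAdjoint_inner hqsa, inner_zero_left]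
      have hw : q w ∈ N := congrArg (fun T : H →L[ℂ] H => T w) hmul
      exact Submodule.inner_left_of_mem_orthogonal hw (N.sub_starProjection_mem_orthogonal x)
    have h2 := ((nonneg_iff_isPositive p).1 hp).re_inner_nonneg_right (x - N.starProjection x)
    rw [hinner, h1, inner_zero_right, map_zero]
    linarith

/-- If `a ≤ T ≤ b` on the range of a projection `Q` commuting with `T`, then the commutator of `T`
and `S` is bounded by `2 (b - a) ‖S‖` there. -/
lemma norm_inner_commutator_le {T Q : H →L[ℂ] H} (S : H →L[ℂ] H) (hT : IsSelfAdjoint T)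
    (hQ : IsStarProjection Q) (hQT : Commute Q T) {a b : ℝ} (hab : a ≤ b)
    (ha : ∀ x, a * ‖Q x‖ ^ 2 ≤ RCLike.re (inner ℂ (Q x) (T (Q x))))
    (hb : ∀ x, RCLike.re (inner ℂ (Q x) (T (Q x))) ≤ b * ‖Q x‖ ^ 2) (x : H) :
    ‖(inner ℂ (Q x) ((T * S - S * T) (Q x)) : ℂ)‖ ≤ 2 * (b - a) * ‖S‖ * ‖Q x‖ ^ 2 := by
  have hQQ : ∀ z, Q (Q z) = Q z := fun z =>
    congrArg (fun T : H →L[ℂ] H => T z) hQ.isIdempotentElem.eq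
  have hQsa := hQ.isSelfAdjoint
  have hQT' : ∀ z, Q (T z) = T (Q z) := fun z => congrArg (fun T : H →L[ℂ] H => T z) hQT.eq
  have hnorm : ∀ z, ‖Q z‖ ≤ ‖z‖ := by
    intro z
    by_contra! hlt
    have h1 : ‖Q z‖ ^ 2 ≤ ‖z‖ * ‖Q z‖ := by
      rw [← inner_self_eq_norm_sq (𝕜 := ℂ), isSelfAdjoint_inner hQsa, hQQ]
      exact re_inner_le_norm _ _
    nlinarith [norm_nonneg z]
  have hasub : IsSelfAdjoint (T - algebraMap ℝ (H →L[ℂ] H) a) :=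
    hT.sub (IsSelfAdjoint.algebraMap _ (IsSelfAdjoint.all a))
  -- Shifting `T` by a scalar does not change the commutator. The compression `X` satisfies `0 ≤ X ≤
  -- b - a`, hence `‖X‖ ≤ b - a`.
  set X : H →L[ℂ] H := Q * (T - algebraMap ℝ _ a) * Q with hX
  have hXsa : IsSelfAdjoint X := by
    rw [hX, IsSelfAdjoint, star_mul, star_mul, hQsa.star_eq, hasub.star_eq, mul_assoc]
  have hXz : ∀ z, X z = T (Q z) - (a : ℂ) • Q z := by
    intro z
    have : X z = Q (T (Q z) - (algebraMap ℝ (H →L[ℂ] H) a) (Q z)) := rfl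
    rw [this, Algebra.algebraMap_eq_smul_one]
    have h2 : (a • (1 : H →L[ℂ] H)) (Q z) = (a : ℂ) • Q z := by simp
    rw [h2, map_sub, map_smul, hQT', hQQ]
  have hXre : ∀ z, RCLike.re (inner ℂ (X z) z) =
      RCLike.re (inner ℂ (Q z) (T (Q z))) - a * ‖Q z‖ ^ 2 := by
    intro z
    have h0 : X z = Q (X z) := by rw [hXz, map_sub, map_smul, hQT', hQQ]
    rw [h0, isSelfAdjoint_inner hQsa, hXz, inner_sub_left, inner_smul_left, map_sub,
      isSelfAdjoint_inner hT]
    congr 1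
    rw [← inner_self_eq_norm_sq (𝕜 := ℂ), Complex.conj_ofReal]
    exact Complex.re_ofReal_mul _ _
  have hX0 : 0 ≤ X := by
    rw [nonneg_iff_isPositive]
    refine ⟨hXsa.isSymmetric, fun z => ?_⟩
    have := ha z
    change 0 ≤ RCLike.re (inner ℂ (X z) z)
    rw [hXre]
    linarith
  have hXle : X ≤ algebraMap ℝ _ (b - a) := by
    rw [← sub_nonneg, nonneg_iff_isPositive]
    refine ⟨((IsSelfAdjoint.algebraMap _ (IsSelfAdjoint.all (b - a))).sub hXsa).isSymmetric,
      fun z => ?_⟩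
    change 0 ≤ RCLike.re (inner ℂ ((algebraMap ℝ (H →L[ℂ] H) (b - a)) z - X z) z)
    have h2 : (algebraMap ℝ (H →L[ℂ] H) (b - a)) z = ((b - a : ℝ) : ℂ) • z := by
      rw [Algebra.algebraMap_eq_smul_one]
      exact (Complex.coe_smul _ _).symm
    have h3 : RCLike.re (inner ℂ (((b - a : ℝ) : ℂ) • z) z) = (b - a) * ‖z‖ ^ 2 := by
      rw [inner_smul_left, ← inner_self_eq_norm_sq (𝕜 := ℂ), Complex.conj_ofReal]
      exact Complex.re_ofReal_mul _ _
    rw [h2, inner_sub_left, map_sub, h3, hXre]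
    have h4 := hb z
    have h5 : ‖Q z‖ ^ 2 ≤ ‖z‖ ^ 2 := by gcongr; exact hnorm z
    nlinarith
  have hXn : ‖X‖ ≤ b - a := (CStarAlgebra.norm_le_iff_le_algebraMap X (sub_nonneg.2 hab) hX0).2 hXle
  set y := Q x with hy
  have hXy : X y = T y - (a : ℂ) • y := by rw [hXz, hy, hQQ]
  have heq : (inner ℂ y ((T * S - S * T) y) : ℂ) = inner ℂ (X y) (S y) - inner ℂ y (S (X y)) := by
    change (inner ℂ y (T (S y) - S (T y)) : ℂ) = _
    rw [hXy, inner_sub_right, ← isSelfAdjoint_inner hT, map_sub, map_smul, inner_sub_right,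
      inner_sub_left, inner_smul_left, inner_smul_right, Complex.conj_ofReal]
    ring
  rw [heq]
  have h1 : ‖X y‖ ≤ (b - a) * ‖y‖ := (X.le_opNorm y).trans (by gcongr)
  have h2 : ‖S (X y)‖ ≤ ‖S‖ * ((b - a) * ‖y‖) := (S.le_opNorm _).trans (by gcongr)
  have h3 := S.le_opNorm y
  have h4 : ‖(inner ℂ (X y) (S y) : ℂ)‖ ≤ ((b - a) * ‖y‖) * (‖S‖ * ‖y‖) :=
    (norm_inner_le_norm _ _).trans (by gcongr)
  have h5 : ‖(inner ℂ y (S (X y)) : ℂ)‖ ≤ ‖y‖ * (‖S‖ * ((b - a) * ‖y‖)) :=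
    (norm_inner_le_norm _ _).trans (by gcongr)
  calc _ ≤ _ := norm_sub_le _ _
    _ ≤ ((b - a) * ‖y‖) * (‖S‖ * ‖y‖) + ‖y‖ * (‖S‖ * ((b - a) * ‖y‖)) := add_le_add h4 h5
    _ = _ := by ring

/-- Bisection of the bound `norm_inner_commutator_le` along spectral projections of `T`. -/
lemma norm_inner_commutator_le_div {T S : H →L[ℂ] H} (hT : IsSelfAdjoint T)
    (hS : ∀ P : H →L[ℂ] H, IsStarProjection P →
      (∀ Q, Commute T Q → Commute T (star Q) → Commute P Q) → Commute P S) (n : ℕ) :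
    ∀ (Q : H →L[ℂ] H), IsStarProjection Q → Commute Q T → ∀ a b : ℝ, a ≤ b →
    (∀ x, a * ‖Q x‖ ^ 2 ≤ RCLike.re (inner ℂ (Q x) (T (Q x)))) →
    (∀ x, RCLike.re (inner ℂ (Q x) (T (Q x))) ≤ b * ‖Q x‖ ^ 2) → ∀ x : H,
    ‖(inner ℂ (Q x) ((T * S - S * T) (Q x)) : ℂ)‖ ≤ 2 * ((b - a) / 2 ^ n) * ‖S‖ * ‖Q x‖ ^ 2 := by
  induction n with
  | zero =>
    intro Q hQ hQT a b hab ha hb x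
    simpa using norm_inner_commutator_le S hT hQ hQT hab ha hb x
  | succ n ih =>
    intro Q hQ hQT a b hab ha hb x
    obtain ⟨P, hP, hcomm, hle, hge⟩ := exists_spectralProjection hT ((a + b) / 2)
    have hPT : Commute P T := hcomm T (Commute.refl T) (by rw [hT.star_eq])
    have hPQ : Commute P Q :=
      hcomm Q hQT.symm (by rw [hQ.isSelfAdjoint.star_eq]; exact hQT.symm)
    have hPS : Commute P S := hS P hP hcomm
    have hPQ' : ∀ z, P (Q z) = Q (P z) := fun z =>
      congrArg (fun T : H →L[ℂ] H => T z) hPQ.eq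
    have hQ1 : IsStarProjection (P * Q) := hP.mul hQ hPQ
    have hQ2 : IsStarProjection ((1 - P) * Q) :=
      hP.one_sub.mul hQ ((Commute.one_left Q).sub_left hPQ)
    have e2 : ∀ z, ((1 - P) * Q) z = Q z - P (Q z) := fun z => rfl
    have e2' : ∀ z, ((1 - P) * Q) z = Q (z - P z) := fun z => by rw [e2, map_sub, hPQ']
    have e1' : ∀ z, (P * Q) z = Q (P z) := hPQ'
    have i1 := ih (P * Q) hQ1 (hPT.mul_left hQT) a ((a + b) / 2) (by linarith)
      (fun z => by rw [e1']; exact ha (P z)) (fun z => hle (Q z)) x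
    have i2 := ih ((1 - P) * Q) hQ2 (((Commute.one_left T).sub_left hPT).mul_left hQT)
      ((a + b) / 2) b (by linarith) (fun z => hge (Q z))
      (fun z => by rw [e2']; exact hb (z - P z)) x
    rw [e2] at i2
    change ‖(inner ℂ (P (Q x)) ((T * S - S * T) (P (Q x))) : ℂ)‖ ≤ _ * ‖P (Q x)‖ ^ 2 at i1
    set y := Q x with hy
    set D := T * S - S * T with hD
    -- Because `P` commutes with the commutator `D`, its form splits over the ranges of `P` and `1 -
    -- P` without cross terms. On each piece the interval has half the length, and the squared norms
    -- add up.
    have hPD : Commute P D := (hPT.mul_right hPS).sub_right (hPS.mul_right hPT)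
    have hPD' : ∀ z, D (P z) = P (D z) := fun z =>
      (congrArg (fun T : H →L[ℂ] H => T z) hPD.eq).symm
    have hPP : ∀ z, P (P z) = P z := fun z =>
      congrArg (fun T : H →L[ℂ] H => T z) hP.isIdempotentElem.eq
    have hsplit : ∀ w z : H, inner ℂ w z =
        (inner ℂ (P w) (P z) : ℂ) + inner ℂ (w - P w) (z - P z) := by
      intro w z
      simp only [inner_sub_left, inner_sub_right, isSelfAdjoint_inner hP.isSelfAdjoint, hPP]
      ring
    have h1 : (inner ℂ y (D y) : ℂ) =
        inner ℂ (P y) (D (P y)) + inner ℂ (y - P y) (D (y - P y)) := by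
      rw [hsplit, map_sub, hPD']
    have h2 : ‖y‖ ^ 2 = ‖P y‖ ^ 2 + ‖y - P y‖ ^ 2 := by
      simp only [← inner_self_eq_norm_sq (𝕜 := ℂ)]
      rw [hsplit, map_add]
    rw [h1, h2]
    refine (norm_add_le _ _).trans ((add_le_add i1 i2).trans (le_of_eq ?_))
    rw [pow_succ]
    ring

/-- Starting the bisection from `Q = 1` and the interval `[-‖T‖, ‖T‖]`, the bounds tend to zero. So
the quadratic form of the commutator vanishes, and over `ℂ` the commutator does too. -/
lemma commute_of_commute_spectralProjections {T S : H →L[ℂ] H} (hT : IsSelfAdjoint T)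
    (hS : ∀ P : H →L[ℂ] H, IsStarProjection P →
      (∀ Q, Commute T Q → Commute T (star Q) → Commute P Q) → Commute P S) : Commute T S := by
  have hbound : ∀ x, |RCLike.re (inner ℂ x (T x))| ≤ ‖T‖ * ‖x‖ ^ 2 := by
    intro x
    refine (RCLike.abs_re_le_norm _).trans ((norm_inner_le_norm _ _).trans ?_)
    have := T.le_opNorm x
    nlinarith [norm_nonneg x]
  have h1 : ∀ x : H, (inner ℂ x ((T * S - S * T) x) : ℂ) = 0 := by
    intro x
    have h := fun n => norm_inner_commutator_le_div hT hS n 1 (IsStarProjection.one _)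
      (Commute.one_left T) (-‖T‖) ‖T‖ (by linarith [norm_nonneg T])
      (fun x => by have := (abs_le.1 (hbound x)).1; simpa using this)
      (fun x => (abs_le.1 (hbound x)).2) x
    have hlim : Filter.Tendsto (fun n : ℕ => 2 * ((‖T‖ - -‖T‖) / 2 ^ n) * ‖S‖ * ‖x‖ ^ 2)
        Filter.atTop (nhds (2 * 0 * ‖S‖ * ‖x‖ ^ 2)) := by
      refine Filter.Tendsto.mul_const _ (Filter.Tendsto.mul_const _ (Filter.Tendsto.const_mul _ ?_))
      exact Filter.Tendsto.div_atTop tendsto_const_nhds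
        (tendsto_pow_atTop_atTop_of_one_lt one_lt_two)
    have := ge_of_tendsto' hlim h
    simpa using this
  rw [commute_iff_eq, ← sub_eq_zero]
  have h2 := (inner_map_self_eq_zero ((T * S - S * T : H →L[ℂ] H) : H →ₗ[ℂ] H)).1 fun x => by
    rw [← inner_conj_symm, coe_coe, h1, map_zero]
  exact ContinuousLinearMap.coe_injective h2

/-- A noncommutative commutant contains a nonzero operator of square zero. -/
lemma exists_sq_eq_zero {G : Set (H →L[ℂ] H)} (hG : ∀ S ∈ G, star S ∈ G)
    (h : ∃ S ∈ G.centralizer, ∃ T ∈ G.centralizer, S * T ≠ T * S) :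
    ∃ a ∈ G.centralizer, a ≠ 0 ∧ a * a = 0 := by
  obtain ⟨S, hS, T, hT, hne⟩ := h
  by_contra! hcon
  have hzero : ∀ a ∈ G.centralizer, a * a = 0 → a = 0 := fun a ha h => by
    by_contra h0
    exact hcon a ha h0 h
  refine hne (Commute.eq (centralizer_induction hG (p := fun T => Commute S T)
    (fun _ _ => Commute.add_right) (fun c _ h => h.smul_right c) ?_ hT))
  intro T hT hsa
  refine (commute_of_commute_spectralProjections hsa fun P hP hcomm => ?_).symm
  have hPG : P ∈ G.centralizer := fun Q hQ =>
    (hcomm Q (hT Q hQ).symm (hT _ (hG Q hQ)).symm).eq.symm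
  have hPP := hP.isIdempotentElem.eq
  have hP' : (1 - P) ∈ G.centralizer := by
    intro Q hQ
    rw [mul_sub, sub_mul, hPG Q hQ, one_mul, mul_one]
  -- If zero is the only square-zero element of the centralizer, both off-diagonal corners of `S`
  -- with respect to `P` vanish, that is, `P` commutes with `S`.
  have e1 : P * S * (1 - P) = 0 := by
    refine hzero _ (Set.mul_mem_centralizer (Set.mul_mem_centralizer hPG hS) hP') ?_
    have : (1 - P) * P = 0 := by rw [sub_mul, hPP, one_mul, sub_self]
    calc P * S * (1 - P) * (P * S * (1 - P)) = P * S * ((1 - P) * P) * S * (1 - P) := by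
          noncomm_ring
      _ = 0 := by rw [this]; simp
  have e2 : (1 - P) * S * P = 0 := by
    refine hzero _ (Set.mul_mem_centralizer (Set.mul_mem_centralizer hP' hS) hPG) ?_
    have : P * (1 - P) = 0 := by rw [mul_sub, hPP, mul_one, sub_self]
    calc (1 - P) * S * P * ((1 - P) * S * P) = (1 - P) * S * (P * (1 - P)) * S * P := by
          noncomm_ring
      _ = 0 := by rw [this]; simp
  rw [mul_sub, mul_one, sub_eq_zero] at e1
  rw [sub_mul, sub_mul, one_mul, sub_eq_zero] at e2
  rw [commute_iff_eq, e1, e2]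

/-- A noncommutative commutant yields a pair of orthonormal vectors that cannot be told apart, nor
connected, by the operators in `G`. -/
lemma exists_indistinguishable_pair {G : Set (H →L[ℂ] H)} (hG : ∀ S ∈ G, star S ∈ G)
    (h : ∃ S ∈ G.centralizer, ∃ T ∈ G.centralizer, S * T ≠ T * S) :
    ∃ x y : H, ‖x‖ = 1 ∧ ‖y‖ = 1 ∧ inner ℂ x y = 0 ∧ (∀ S ∈ G, inner ℂ x (S y) = 0) ∧
      ∀ S ∈ G, inner ℂ x (S x) = inner ℂ y (S y) := by
  obtain ⟨a, ha, ha0, haa⟩ := exists_sq_eq_zero hG h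
  have hstar := star_mem_centralizer hG ha
  -- The pair will be `r w, a w`. From `r² = a* a` and `a² = 0` follows `r a = 0`, the
  -- orthogonality; and `r S r = a* S a` for `S ∈ G` gives equal expectations.
  set r := CFC.abs a with hr
  have hrsa : IsSelfAdjoint r := IsSelfAdjoint.of_nonneg (CFC.abs_nonneg a)
  have hrr : r * r = star a * a := CFC.abs_mul_abs a
  have hra : r * a = 0 := by
    rw [← CStarRing.star_mul_self_eq_zero_iff, star_mul, hrsa.star_eq, mul_assoc, ← mul_assoc r,
      hrr, mul_assoc, haa, mul_zero, mul_zero]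
  have hrS : ∀ S ∈ G, Commute r S := fun S hS =>
    Commute.cfcAbs_left (ha S hS).symm (ha _ (hG S hS)).symm
  obtain ⟨u, hu⟩ : ∃ u, a u ≠ 0 := by
    by_contra! hcon
    exact ha0 (ContinuousLinearMap.ext hcon)
  set w : H := (‖a u‖⁻¹ : ℂ) • u with hw
  have haw : ‖a w‖ = 1 := by rw [hw, map_smul]; exact norm_smul_inv_norm hu
  have key1 : ∀ S, Commute r S → inner ℂ (r w) (S (a w)) = 0 := by
    intro S hS
    have h1 : r (S (a w)) = 0 := by
      have : r * S * a = 0 := by rw [hS.eq, mul_assoc, hra, mul_zero]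
      exact congrArg (fun T : H →L[ℂ] H => T w) this
    rw [isSelfAdjoint_inner hrsa, h1, inner_zero_right]
  have key2 : ∀ S, Commute r S → Commute (star a) S →
      inner ℂ (r w) (S (r w)) = inner ℂ (a w) (S (a w)) := by
    intro S h1 h2
    have h3 : r (S (r w)) = star a (S (a w)) := by
      have : r * S * r = star a * S * a := by rw [h1.eq, h2.eq, mul_assoc, mul_assoc, hrr]
      exact congrArg (fun T : H →L[ℂ] H => T w) this
    rw [isSelfAdjoint_inner hrsa, h3, star_eq_adjoint, adjoint_inner_right]
  have hrw : ‖r w‖ = 1 := by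
    have h1 := key2 1 (Commute.one_right _) (Commute.one_right _)
    have h2 : inner ℂ (r w) (r w) = inner ℂ (a w) (a w) := h1
    rw [inner_self_eq_norm_sq_to_K, inner_self_eq_norm_sq_to_K, haw] at h2
    have h3 : ‖r w‖ ^ 2 = 1 := by
      have h4 : ((‖r w‖ ^ 2 : ℝ) : ℂ) = ((1 : ℝ) : ℂ) := by simpa using h2
      exact_mod_cast h4
    exact (pow_eq_one_iff_of_nonneg (norm_nonneg _) two_ne_zero).1 h3
  exact ⟨r w, a w, hrw, haw, key1 1 (Commute.one_right _), fun S hS => key1 S (hrS S hS),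
    fun S hS => key2 S (hrS S hS) (hstar S hS).symm⟩

end OperatorAlgebra

/-! ### From the commutant to positive capacities. -/

section Capacity

variable {A : Type*} [NormedAddCommGroup A] [InnerProductSpace ℂ A] [CompleteSpace A]
variable {B : Type*} [NormedAddCommGroup B] [InnerProductSpace ℂ B] [CompleteSpace B]
variable {E : Type*} [NormedAddCommGroup E] [InnerProductSpace ℂ E] [CompleteSpace E]
variable (V : A →ₗᵢ[ℂ] HilbertTensor B E)

/-- The operators `Wₑ* W_f`. -/
def krausProducts : Set (A →L[ℂ] A) :=
  {S | ∃ e f, S = adjoint (kraus V e) ∘L kraus V f}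

lemma star_mem_krausProducts : ∀ S ∈ krausProducts V, star S ∈ krausProducts V := by
  rintro _ ⟨e, f, rfl⟩
  exact ⟨f, e, by rw [star_eq_adjoint, adjoint_comp, adjoint_adjoint]⟩

/-- Codes are tested only on the products `W_e* W_f`, so this inclusion suffices and no density of
their span in the graph is needed. -/
lemma commutant_subset_centralizer_krausProducts :
    commutant (noncommutativeGraph V) ⊆ (krausProducts V).centralizer := by
  rintro T hT _ ⟨e, f, rfl⟩
  exact hT _ (adjoint_kraus_comp_kraus_mem V e f)

lemma commutant_ne_scalars_iff (G : Set (A →L[ℂ] A)) :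
    commutant G ≠ Set.range (fun c : ℂ => c • (1 : A →L[ℂ] A)) ↔
      ∃ T ∈ commutant G, ∀ c : ℂ, T ≠ c • 1 := by
  have hsub : Set.range (fun c : ℂ => c • (1 : A →L[ℂ] A)) ⊆ commutant G := by
    rintro _ ⟨c, rfl⟩ S _
    simp
  constructor
  · intro h
    by_contra! hcon
    refine h (Set.Subset.antisymm (fun T hT => ?_) hsub)
    obtain ⟨c, hc⟩ := hcon T hT
    exact ⟨c, hc.symm⟩
  · rintro ⟨T, hT, hc⟩ h
    rw [h] at hT
    obtain ⟨c, rfl⟩ := hT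
    exact hc c rfl

/-- Turns positivity of a capacity into the existence of a code with more than one element,
respectively of dimension greater than one. -/
lemma zero_lt_log_iff {n : ℕ∞} : 0 < ENNReal.log (n : ENNReal) ↔ 1 < n := by
  rw [← ENNReal.log_one, ENNReal.log_lt_log_iff]
  exact_mod_cast Iff.rfl

/-- The output supports lie in the closed spans of the vectors `W_e x` and `W_f y`, which are
orthogonal; the two pure states form the code. -/
lemma classicalCapacity_pos {x y : A} (hx : ‖x‖ = 1) (hy : ‖y‖ = 1) (hxy : inner ℂ x y = 0)
    (h : ∀ e f, inner ℂ (kraus V e x) (kraus V f y) = 0) :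
    0 < classicalCapacity (stinespringChannel V) := by
  have hne : ketBra x x ≠ ketBra y y := by
    intro heq
    have h1 : rankOne ℂ x x x = rankOne ℂ y y x :=
      congrArg (fun T : traceClass A => (T : A →L[ℂ] A) x) heq
    rw [rankOne_apply, rankOne_apply, inner_eq_zero_symm.1 hxy, zero_smul,
      inner_self_eq_norm_sq_to_K, hx] at h1
    have : x = 0 := by simpa using h1
    rw [this, norm_zero] at hx
    exact zero_ne_one hx
  have hort : supp (stinespringChannel V (ketBra x x) : B →L[ℂ] B) ⟂
      supp (stinespringChannel V (ketBra y y) : B →L[ℂ] B) := by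
    refine (Submodule.IsOrtho.mono (supp_stinespringChannel_ketBra_le V x)
      (supp_stinespringChannel_ketBra_le V y) ?_)
    have h1 : Submodule.span ℂ (Set.range fun e => kraus V e x) ⟂
        Submodule.span ℂ (Set.range fun e => kraus V e y) := by
      rw [Submodule.isOrtho_span]
      rintro _ ⟨e, rfl⟩ _ ⟨f, rfl⟩
      exact h e f
    exact Submodule.orthogonal_le (Submodule.orthogonal_le h1)
  refine lt_of_lt_of_le ?_ (le_iSup₂ (f := fun S (_ : S ∈ classicalCodes (stinespringChannel V)) =>
    ENNReal.log (S.encard : ENNReal)) {ketBra x x, ketBra y y} ⟨?_, ?_⟩)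
  · rw [zero_lt_log_iff, Set.encard_pair hne]
    norm_num
  · rintro _ (rfl | rfl)
    · exact isState_ketBra hx
    · exact isState_ketBra hy
  · rw [Set.pairwise_pair]
    exact fun _ => ⟨hort, hort.symm⟩

/-- These are the Knill–Laflamme conditions. Equal Gram matrices provide the partial isometry `W_e x
↦ W_e y`, orthogonality makes its square zero, and `recovery` reverses the channel on the span of
`x, y`. -/
lemma quantumCapacity_pos {x y : A} (hx : ‖x‖ = 1) (hy : ‖y‖ = 1) (hxy : inner ℂ x y = 0)
    (htr : ∀ T, trace (stinespringChannel V T : B →L[ℂ] B) = trace (T : A →L[ℂ] A))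
    (h : ∀ e f, inner ℂ (kraus V e x) (kraus V f y) = 0)
    (h' : ∀ e f, inner ℂ (kraus V e x) (kraus V f x) = inner ℂ (kraus V e y) (kraus V f y)) :
    0 < quantumCapacity (stinespringChannel V) := by
  obtain ⟨v, hv, hv'⟩ := exists_partialIsometry (fun e => kraus V e x) (fun e => kraus V e y) h'
  have h2 : ∀ e, v (kraus V e y) = 0 := fun e => hv' _ fun f => h f e
  have h3 : ∀ e, adjoint v (kraus V e y) = kraus V e x := adjoint_partialIsometry h' hv hv'
  have h4 : ∀ e, adjoint v (kraus V e x) = 0 := fun e =>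
    adjoint_partialIsometry_eq_zero hv hv' fun f => h e f
  have hvv : v ∘L v = 0 := ext_of_orthogonal (fun e => kraus V e x)
    (fun e => by simp [hv, h2]) fun z hz => by simp [hv' z hz]
  have hvvv : v ∘L adjoint v ∘L v = v := ext_of_orthogonal (fun e => kraus V e x)
    (fun e => by simp [hv, h3]) fun z hz => by simp [hv' z hz]
  have hfin : FiniteDimensional ℂ (Submodule.span ℂ ({x, y} : Set A)) :=
    FiniteDimensional.span_of_finite ℂ (by simp)
  refine lt_of_lt_of_le ?_ (le_iSup₂ (f := fun L (_ : L ∈ quantumCodes (stinespringChannel V)) =>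
    ENNReal.log (Cardinal.toENat (Module.rank ℂ L) : ENNReal)) (Submodule.span ℂ {x, y}) ⟨?_, ?_⟩)
  · have hli : LinearIndependent ℂ ![x, y] := by
      refine Orthonormal.linearIndependent ⟨fun i => ?_, fun i j hij => ?_⟩
      · fin_cases i
        · exact hx
        · exact hy
      · fin_cases i <;> fin_cases j <;> simp_all [inner_eq_zero_symm]
    have hrank := finrank_span_eq_card hli
    rw [Matrix.range_cons_cons_empty, Fintype.card_fin] at hrank
    rw [zero_lt_log_iff, Cardinal.one_lt_toENat, ← Module.finrank_eq_rank, hrank]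
    norm_num
  · exact Submodule.closed_of_finiteDimensional _
  · exact ⟨recovery v x y, isQuantumChannel_recovery hx hy hxy hvv hvvv, fun ρ hρ hsupp =>
      recovery_stinespringChannel V hx hy hxy htr hv h2 h3 h4 (mem_span_ketBra hx hy hxy hρ hsupp)⟩

lemma inner_krausProduct (e f : E) (x y : A) :
    inner ℂ x ((adjoint (kraus V e) ∘L kraus V f) y) = inner ℂ (kraus V e x) (kraus V f y) := by
  rw [comp_apply, adjoint_inner_right]

lemma classicalCapacity_pos_of_commutant_ne
    (h : commutant (noncommutativeGraph V) ≠ Set.range (fun c : ℂ => c • (1 : A →L[ℂ] A))) :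
    0 < classicalCapacity (stinespringChannel V) := by
  obtain ⟨T, hT, hc⟩ := (commutant_ne_scalars_iff _).1 h
  obtain ⟨x, y, hx, hy, hxy, hS⟩ := exists_orthogonal_pair (star_mem_krausProducts V)
    ⟨T, commutant_subset_centralizer_krausProducts V hT, hc⟩
  refine classicalCapacity_pos V hx hy hxy fun e f => ?_
  rw [← inner_krausProduct]
  exact hS _ ⟨e, f, rfl⟩

lemma quantumCapacity_pos_of_isNoncommutative
    (htr : ∀ T, trace (stinespringChannel V T : B →L[ℂ] B) = trace (T : A →L[ℂ] A))
    (h : IsNoncommutative (commutant (noncommutativeGraph V))) :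
    0 < quantumCapacity (stinespringChannel V) := by
  obtain ⟨S, hS, T, hT, hne⟩ := h
  obtain ⟨x, y, hx, hy, hxy, h1, h2⟩ := exists_indistinguishable_pair (star_mem_krausProducts V)
    ⟨S, commutant_subset_centralizer_krausProducts V hS, T,
      commutant_subset_centralizer_krausProducts V hT, hne⟩
  refine quantumCapacity_pos V hx hy hxy htr (fun e f => ?_) fun e f => ?_
  · rw [← inner_krausProduct]
    exact h1 _ ⟨e, f, rfl⟩
  · rw [← inner_krausProduct, ← inner_krausProduct]
    exact h2 _ ⟨e, f, rfl⟩

end Capacity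

/-! ### From positive capacities back to the commutant when the graph is an algebra. -/

section Converse

variable {A : Type*} [NormedAddCommGroup A] [InnerProductSpace ℂ A] [CompleteSpace A]
variable {B : Type*} [NormedAddCommGroup B] [InnerProductSpace ℂ B] [CompleteSpace B]
variable {E : Type*} [NormedAddCommGroup E] [InnerProductSpace ℂ E] [CompleteSpace E]
variable (V : A →ₗᵢ[ℂ] HilbertTensor B E)

lemma IsState.exists_apply_ne_zero {ρ : traceClass A} (hρ : IsState ρ) :
    ∃ a, (ρ : A →L[ℂ] A) a ≠ 0 := by
  by_contra! hcon
  have h0 : (ρ : A →L[ℂ] A) = 0 := ContinuousLinearMap.ext hcon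
  have := hρ.trace_eq_one
  rw [h0, trace_zero] at this
  exact zero_ne_one this

/-- Any nonzero vectors in the ranges of two distinct code states will do, since `W_e` maps the
range of a state into the support of its output. -/
lemma exists_orthogonal_of_classicalCapacity_pos
    (h : 0 < classicalCapacity (stinespringChannel V)) :
    ∃ x y : A, x ≠ 0 ∧ y ≠ 0 ∧ ∀ e f, inner ℂ (kraus V e x) (kraus V f y) = 0 := by
  obtain ⟨S, hS⟩ := lt_iSup_iff.1 h
  obtain ⟨⟨hstate, hpair⟩, hS⟩ := lt_iSup_iff.1 hS
  obtain ⟨ρ, σ, hρ, hσ, hne⟩ := Set.one_lt_encard_iff.1 (zero_lt_log_iff.1 hS)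
  obtain ⟨a, ha⟩ := (hstate ρ hρ).exists_apply_ne_zero
  obtain ⟨b, hb⟩ := (hstate σ hσ).exists_apply_ne_zero
  exact ⟨_, _, ha, hb, fun e f => Submodule.isOrtho_iff_inner_eq.1 (hpair hρ hσ hne) _
    (kraus_mem_supp V (hstate ρ hρ) e a) _ (kraus_mem_supp V (hstate σ hσ) f b)⟩

lemma commutant_ne_of_classicalCapacity_pos (halg : IsAlgebra (noncommutativeGraph V))
    (h : 0 < classicalCapacity (stinespringChannel V)) :
    commutant (noncommutativeGraph V) ≠ Set.range (fun c : ℂ => c • (1 : A →L[ℂ] A)) := by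
  obtain ⟨x, y, hx, hy, hxy⟩ := exists_orthogonal_of_classicalCapacity_pos V h
  obtain ⟨S, hS⟩ := halg
  have hSmem : ∀ Q, Q ∈ S ↔ Q ∈ noncommutativeGraph V := fun Q => by rw [← hS]; rfl
  -- The orbit of `y` under the graph. Its closure is reducing, contains `y` because the algebra is
  -- unital, and is orthogonal to `x`.
  set N₀ : Submodule ℂ A :=
    (Subalgebra.toSubmodule S).map (ContinuousLinearMap.apply ℂ A y : (A →L[ℂ] A) →ₗ[ℂ] A) with hN₀
  have hmem : ∀ z, z ∈ N₀ ↔ ∃ Q ∈ S, Q y = z := fun z => by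
    simp [hN₀, Submodule.mem_map]
  set N := N₀.topologicalClosure with hN
  have hinv : ∀ Q ∈ S, ∀ z ∈ N, Q z ∈ N := by
    intro Q hQ z hz
    refine map_mem_closure Q.continuous hz fun w hw => ?_
    obtain ⟨R, hR, rfl⟩ := (hmem w).1 hw
    exact (hmem _).2 ⟨Q * R, S.mul_mem hQ hR, rfl⟩
  refine (commutant_ne_scalars_iff _).2 ⟨N.starProjection, fun Q hQ => ?_, fun c hc => ?_⟩
  · refine (commute_starProjection N (hinv Q ((hSmem Q).2 hQ)) (hinv _ ((hSmem _).2 ?_))).eq.symm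
    exact adjoint_mem_noncommutativeGraph V hQ
  · have hyN : y ∈ N := N₀.le_topologicalClosure ((hmem y).2 ⟨1, S.one_mem, rfl⟩)
    have hxN : x ∈ Nᗮ := by
      rw [hN, Submodule.orthogonal_closure]
      intro z hz
      obtain ⟨Q, hQ, rfl⟩ := (hmem z).1 hz
      rw [inner_eq_zero_symm]
      exact inner_graph_eq_zero V hxy ((hSmem Q).1 hQ)
    have h1 : c • y = y := by
      rw [← Submodule.starProjection_eq_self_iff.2 hyN]
      conv_rhs => rw [Submodule.starProjection_eq_self_iff.2 hyN, ←
        Submodule.starProjection_eq_self_iff.2 hyN, hc]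
      simp [Submodule.starProjection_eq_self_iff.2 hyN]
    have h2 : c • x = 0 := by
      have := (Submodule.starProjection_apply_eq_zero_iff N).2 hxN
      rw [hc] at this
      exact this
    rcases smul_eq_zero.1 h2 with rfl | h3
    · exact hy (by rw [← h1, zero_smul])
    · exact hx h3

/-- Error-correction conditions for an algebra make the commutant noncommutative. -/
lemma isNoncommutative_of_indistinguishable (halg : IsAlgebra (noncommutativeGraph V)) {x y : A}
    (hx : ‖x‖ = 1) (h : ∀ e f, inner ℂ (kraus V e x) (kraus V f y) = 0)
    (h' : ∀ e f, inner ℂ (kraus V e x) (kraus V f x) = inner ℂ (kraus V e y) (kraus V f y)) :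
    IsNoncommutative (commutant (noncommutativeGraph V)) := by
  obtain ⟨S, hS⟩ := halg
  have hSmem : ∀ Q, Q ∈ S ↔ Q ∈ noncommutativeGraph V := fun Q => by rw [← hS]; rfl
  have hstar : ∀ Q ∈ S, star Q ∈ S := fun Q hQ =>
    (hSmem _).2 (adjoint_mem_noncommutativeGraph V ((hSmem Q).1 hQ))
  -- Since `P* Q` is again in the graph, equal expectations at `x` and `y` give equal Gram matrices
  -- of the two orbits.
  have hgram : ∀ P Q : S, inner ℂ ((P : A →L[ℂ] A) x) ((Q : A →L[ℂ] A) x) =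
      inner ℂ ((P : A →L[ℂ] A) y) ((Q : A →L[ℂ] A) y) := by
    intro P Q
    have := inner_graph_eq V h' ((hSmem _).1 (S.mul_mem (hstar P P.2) Q.2))
    rw [← adjoint_inner_right, ← adjoint_inner_right]
    exact this
  obtain ⟨v, hv, hv'⟩ := exists_partialIsometry (fun Q : S => (Q : A →L[ℂ] A) x)
    (fun Q : S => (Q : A →L[ℂ] A) y) hgram
  have hvx : v x = y := hv ⟨1, S.one_mem⟩
  have hvy : adjoint v y = x := adjoint_partialIsometry hgram hv hv' ⟨1, S.one_mem⟩
  have hvx' : adjoint v x = 0 := adjoint_partialIsometry_eq_zero hv hv' fun Q =>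
    inner_graph_eq_zero V h ((hSmem _).1 Q.2)
  have hcomm : v ∈ commutant (noncommutativeGraph V) := by
    intro Q hQ
    refine ext_of_orthogonal (fun R : S => (R : A →L[ℂ] A) x) (fun R => ?_) fun z hz => ?_
    · have h1 := hv ⟨Q * R, S.mul_mem ((hSmem Q).2 hQ) R.2⟩
      have h2 := hv R
      change Q (v ((R : A →L[ℂ] A) x)) = v (Q ((R : A →L[ℂ] A) x))
      rw [h2]
      exact h1.symm
    · change Q (v z) = v (Q z)
      rw [hv' z hz, map_zero, hv' (Q z)]
      intro R
      rw [← adjoint_inner_left]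
      exact hz ⟨star Q * R, S.mul_mem (hstar Q ((hSmem Q).2 hQ)) R.2⟩
  refine ⟨star v, star_mem_centralizer (fun Q hQ => adjoint_mem_noncommutativeGraph V hQ) hcomm,
    v, hcomm, fun heq => ?_⟩
  -- At `x` the two products differ: `v* v x = x`, while `v v* x = 0`.
  have h1 : adjoint v (v x) = v (adjoint v x) := congrArg (fun T : A →L[ℂ] A => T x) heq
  rw [hvx, hvy, hvx', map_zero] at h1
  rw [h1, norm_zero] at hx
  exact zero_ne_one hx

lemma IsQuantumChannel.nonneg {Ψ : traceClass B →ₗ[ℂ] traceClass A} (hΨ : IsQuantumChannel Ψ)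
    {T : traceClass B} (hT : ∀ z, 0 ≤ inner ℂ z ((T : B →L[ℂ] B) z)) (z : A) :
    0 ≤ inner ℂ z ((Ψ T : A →L[ℂ] A) z) := by
  have := hΨ.completelyPositive 1 (fun _ _ => T) (fun x => by simpa using hT (x 0)) fun _ => z
  simpa using this

/-- If a channel reverses `Φ` on a pure state, then it reverses each Kraus operator. -/
lemma recovery_kraus {Ψ : traceClass B →ₗ[ℂ] traceClass A} (hΨ : IsQuantumChannel Ψ) {u : A}
    (hu : ‖u‖ = 1) (hrec : Ψ (stinespringChannel V (ketBra u u)) = ketBra u u) (e : E) :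
    Ψ (ketBra (kraus V e u) (kraus V e u)) = ((‖kraus V e u‖ : ℂ) ^ 2) • ketBra u u := by
  have huu : inner ℂ u u = (1 : ℂ) := by rw [inner_self_eq_norm_sq_to_K, hu]; simp
  set R := ketBra (kraus V e u) (kraus V e u) with hR
  set q : A →L[ℂ] A := (Ψ R).1 with hq
  have hRpos : ∀ z, 0 ≤ inner ℂ z ((R : B →L[ℂ] B) z) :=
    (isPositive_rankOne_self (𝕜 := ℂ) (kraus V e u)).inner_nonneg_right
  have hqpos : ∀ z, 0 ≤ inner ℂ z (q z) := hΨ.nonneg hRpos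
  -- By Cauchy–Schwarz in `E`, the Kraus term is at most `‖e‖²` times the full output. Positivity of
  -- `Ψ` turns this into `q ≤ ‖e‖² |u⟩⟨u|`, so `q` is a multiple of `|u⟩⟨u|`, and its trace fixes
  -- the factor.
  have hqle : ∀ z, inner ℂ z (q z) ≤ (‖e‖ : ℂ) ^ 2 * inner ℂ z (rankOne ℂ u u z) := by
    intro z
    have h1 := hΨ.nonneg (T := ((‖e‖ : ℂ) ^ 2) • stinespringChannel V (ketBra u u) - R)
      (fun w => ?_) z
    · rw [map_sub, map_smul, hrec] at h1
      simpa [inner_sub_right, inner_smul_right] using h1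
    · have h2 : inner ℂ w ((((‖e‖ : ℂ) ^ 2 • stinespringChannel V (ketBra u u) - R :
          traceClass B) : B →L[ℂ] B) w) =
          (((‖e‖ * ‖coKraus V w u‖) ^ 2 - ‖(inner ℂ e (coKraus V w u) : ℂ)‖ ^ 2 : ℝ) : ℂ) := by
        change inner ℂ w ((‖e‖ : ℂ) ^ 2 • (stinespringChannel V (ketBra u u) : B →L[ℂ] B) w -
          rankOne ℂ (kraus V e u) (kraus V e u) w) = _
        rw [inner_sub_right, inner_smul_right, inner_stinespringChannel_ketBra, rankOne_apply,
          inner_smul_right, inner_kraus, inner_kraus', inner_self_eq_norm_sq_to_K,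
          mul_comm (inner ℂ (coKraus V w u) e), ← inner_conj_symm (coKraus V w u) e,
          RCLike.mul_conj]
        push_cast
        rw [mul_pow]
        rfl
      rw [h2]
      have h3 := norm_inner_le_norm (𝕜 := ℂ) e (coKraus V w u)
      exact_mod_cast sub_nonneg.2 (pow_le_pow_left₀ (norm_nonneg _) h3 2)
  have hqP : q.IsPositive := by
    rw [isPositive_iff_complex]
    intro z
    have h1 : (starRingEnd ℂ) (inner ℂ z (q z)) = inner ℂ z (q z) :=
      Complex.conj_eq_iff_im.2 (Complex.nonneg_iff.1 (hqpos z)).2.symm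
    rw [← inner_conj_symm, h1]
    exact ⟨Complex.conj_eq_iff_re.1 h1, (Complex.nonneg_iff.1 (hqpos z)).1⟩
  have hq0 : ∀ z, inner ℂ u z = 0 → q z = 0 := by
    intro z hz
    refine eq_zero_of_isPositive_of_inner_eq_zero hqP (le_antisymm ?_ (hqpos z))
    have := hqle z
    rw [rankOne_apply, hz, zero_smul, inner_zero_right, mul_zero] at this
    exact this
  have hqu : q u = inner ℂ u (q u) • u := by
    refine ext_inner_left ℂ fun w => ?_
    have h1 : q (w - inner ℂ u w • u) = 0 := hq0 _ (by
      rw [inner_sub_right, inner_smul_right, huu, mul_one, sub_self])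
    have h2 : inner ℂ (w - inner ℂ u w • u) (q u) = 0 := by
      rw [← isSelfAdjoint_inner hqP.isSelfAdjoint, h1, inner_zero_left]
    rw [inner_sub_left, inner_smul_left, inner_conj_symm, sub_eq_zero] at h2
    rw [h2, inner_smul_right, mul_comm]
  have hqeq : q = inner ℂ u (q u) • rankOne ℂ u u := by
    ext z
    have h1 : q (z - inner ℂ u z • u) = 0 := hq0 _ (by
      rw [inner_sub_right, inner_smul_right, huu, mul_one, sub_self])
    rw [map_sub, map_smul, sub_eq_zero] at h1
    rw [h1]
    conv_lhs => rw [hqu]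
    simp [smul_smul, mul_comm]
  have htr : trace q = (‖kraus V e u‖ : ℂ) ^ 2 := by
    rw [hq, hΨ.tracePreserving, hR, coe_ketBra, trace_rankOne]
    exact inner_self_eq_norm_sq_to_K _
  rw [hqeq, trace_smul, trace_rankOne, huu, mul_one] at htr
  ext1
  rw [← hq, hqeq, htr]
  rfl

/-- A parallelogram identity: the equal mixture of `a, b` is also the equal mixture of their
normalized sum and difference. It is used both in `A` and for the images under `W_e`. -/
lemma ketBra_add_ketBra {c : ℂ} (hc : starRingEnd ℂ c = c) (hc2 : c * c = 1 / 2) (a b : A) :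
    ketBra (c • a + c • b) (c • a + c • b) + ketBra (c • a - c • b) (c • a - c • b) =
      ketBra a a + ketBra b b := by
  ext z
  simp only [Submodule.coe_add, coe_ketBra, add_apply, rankOne_apply, inner_add_left,
    inner_sub_left, inner_smul_left, hc]
  match_scalars
  · linear_combination 2 * inner ℂ a z * hc2
  · linear_combination 2 * inner ℂ b z * hc2

/-- Apply `Ψ` to the two decompositions of one mixture, along `x, y` and along `u, w = (x ± y)/√2`.
Equality of the results makes the squared norms of `W_e x` and `W_e y` agree, and likewise for `u,
w`; the latter says that the real part of the inner product vanishes. -/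
lemma kraus_norm_eq {Ψ : traceClass B →ₗ[ℂ] traceClass A} (hΨ : IsQuantumChannel Ψ)
    {L : Submodule ℂ A}
    (hrec : ∀ u ∈ L, ‖u‖ = 1 → Ψ (stinespringChannel V (ketBra u u)) = ketBra u u) {x y : A}
    (hxL : x ∈ L) (hyL : y ∈ L) (hx : ‖x‖ = 1) (hy : ‖y‖ = 1) (hxy : inner ℂ x y = 0) (e : E) :
    ‖kraus V e x‖ = ‖kraus V e y‖ ∧ RCLike.re (inner ℂ (kraus V e x) (kraus V e y)) = 0 := by
  have hyx : inner ℂ y x = 0 := inner_eq_zero_symm.1 hxy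
  have hxx : inner ℂ x x = (1 : ℂ) := by rw [inner_self_eq_norm_sq_to_K, hx]; simp
  have hyy : inner ℂ y y = (1 : ℂ) := by rw [inner_self_eq_norm_sq_to_K, hy]; simp
  obtain ⟨c, hc, hc2⟩ : ∃ c : ℂ, starRingEnd ℂ c = c ∧ c * c = 1 / 2 := by
    refine ⟨((√2)⁻¹ : ℝ), Complex.conj_ofReal _, ?_⟩
    have : (√2)⁻¹ * (√2)⁻¹ = 1 / 2 := by
      rw [← mul_inv, Real.mul_self_sqrt zero_le_two, one_div]
    rw [← Complex.ofReal_mul, this]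
    norm_num
  have hunit : ∀ z : A, inner ℂ z z = (1 : ℂ) → ‖z‖ = 1 := by
    intro z hz
    rw [inner_self_eq_norm_sq_to_K] at hz
    have h4 : ((‖z‖ ^ 2 : ℝ) : ℂ) = ((1 : ℝ) : ℂ) := by simpa using hz
    exact (pow_eq_one_iff_of_nonneg (norm_nonneg _) two_ne_zero).1 (by exact_mod_cast h4)
  obtain ⟨u, hu⟩ : ∃ u, u = c • x + c • y := ⟨_, rfl⟩
  obtain ⟨w, hw⟩ : ∃ w, w = c • x - c • y := ⟨_, rfl⟩
  have hu1 : ‖u‖ = 1 := hunit _ (by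
    simp only [hu, inner_add_left, inner_add_right, inner_smul_left, inner_smul_right, hxx, hyy,
      hxy, hyx, hc]
    linear_combination 2 * hc2)
  have hw1 : ‖w‖ = 1 := hunit _ (by
    simp only [hw, inner_sub_left, inner_sub_right, inner_smul_left, inner_smul_right, hxx, hyy,
      hxy, hyx, hc]
    linear_combination 2 * hc2)
  have huL : u ∈ L := hu ▸ L.add_mem (L.smul_mem c hxL) (L.smul_mem c hyL)
  have hwL : w ∈ L := hw ▸ L.sub_mem (L.smul_mem c hxL) (L.smul_mem c hyL)
  have hrk := fun z hz hz1 => recovery_kraus V hΨ hz1 (hrec z hz hz1) e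
  have hsum : ketBra (kraus V e u) (kraus V e u) + ketBra (kraus V e w) (kraus V e w) =
      ketBra (kraus V e x) (kraus V e x) + ketBra (kraus V e y) (kraus V e y) := by
    rw [hu, hw, map_add, map_sub, map_smul, map_smul]
    exact ketBra_add_ketBra hc hc2 _ _
  have hΨsum := congrArg Ψ hsum
  rw [map_add, map_add, hrk u huL hu1, hrk w hwL hw1, hrk x hxL hx, hrk y hyL hy] at hΨsum
  -- The diagonal entries compare `x` with `y`, and the off-diagonal entry compares `u` with `w`.
  have hentry : ∀ a b : A, _ := fun a b =>
    congrArg (fun T : traceClass A => inner ℂ a ((T : A →L[ℂ] A) b)) hΨsum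
  have e1 := hentry x x
  have e2 := hentry y y
  have e3 := hentry x y
  have i1 : inner ℂ x u = c := by simp [hu, hx, hxy]
  have i2 : inner ℂ y u = c := by simp [hu, hy, hyx]
  have i3 : inner ℂ x w = c := by simp [hw, hx, hxy]
  have i4 : inner ℂ y w = -c := by simp [hw, hy, hyx]
  have i5 : inner ℂ u x = c := by rw [← inner_conj_symm, i1, hc]
  have i6 : inner ℂ u y = c := by rw [← inner_conj_symm, i2, hc]
  have i7 : inner ℂ w x = c := by rw [← inner_conj_symm, i3, hc]
  have i8 : inner ℂ w y = -c := by rw [← inner_conj_symm, i4, map_neg, hc]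
  simp only [Submodule.coe_add, Submodule.coe_smul, coe_ketBra, add_apply, smul_apply,
    rankOne_apply, inner_add_right, inner_smul_right, hxx, hyy, hxy, hyx, i1, i2, i3, i4, i5, i6,
    i7, i8] at e1 e2 e3
  have hnx : (‖kraus V e x‖ : ℂ) ^ 2 = (‖kraus V e y‖ : ℂ) ^ 2 := by
    linear_combination e2 - e1
  have hnuw : (‖kraus V e u‖ : ℂ) ^ 2 = (‖kraus V e w‖ : ℂ) ^ 2 := by
    linear_combination 2 * e3 - 2 * ((‖kraus V e u‖ : ℂ) ^ 2 - (‖kraus V e w‖ : ℂ) ^ 2) * hc2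
  constructor
  · have : ‖kraus V e x‖ ^ 2 = ‖kraus V e y‖ ^ 2 := by exact_mod_cast hnx
    exact (pow_left_inj₀ (norm_nonneg _) (norm_nonneg _) two_ne_zero).1 this
  · have h1 : ‖kraus V e u‖ ^ 2 = ‖kraus V e w‖ ^ 2 := by exact_mod_cast hnuw
    rw [hu, hw, map_add, map_sub, map_smul, map_smul, norm_add_sq (𝕜 := ℂ),
      norm_sub_sq (𝕜 := ℂ), inner_smul_left, inner_smul_right, ← mul_assoc, hc, hc2] at h1
    have h2 : RCLike.re ((1 / 2 : ℂ) * inner ℂ (kraus V e x) (kraus V e y)) = 0 := by linarith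
    have h3 : ((1 / 2 : ℂ) * inner ℂ (kraus V e x) (kraus V e y)) =
        ((1 / 2 : ℝ) : ℂ) * inner ℂ (kraus V e x) (kraus V e y) := by norm_num
    rw [h3] at h2
    have h4 := (Complex.re_ofReal_mul (1 / 2) (inner ℂ (kraus V e x) (kraus V e y))).symm.trans h2
    change (inner ℂ (kraus V e x) (kraus V e y) : ℂ).re = 0
    linarith

/-- Polarization with `e + f` and `e + i f`. Here `F` is linear in the first argument and
conjugate-linear in the second, because `W_e` is conjugate-linear in `e`. -/
lemma sesquilinear_eq_zero {F : E → E → ℂ} (hadd : ∀ e e' f, F (e + e') f = F e f + F e' f)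
    (hadd' : ∀ e f f', F e (f + f') = F e f + F e f') (hsmul : ∀ c e f, F (c • e) f = c * F e f)
    (hsmul' : ∀ (c : ℂ) e f, F e (c • f) = starRingEnd ℂ c * F e f) (h : ∀ e, F e e = 0) (e f : E) :
    F e f = 0 := by
  have h1 := h (e + f)
  have h2 := h (e + Complex.I • f)
  simp only [hadd, hadd', hsmul, hsmul', h, Complex.conj_I] at h1 h2
  have h3 : Complex.I * (F f e - F e f) = 0 := by linear_combination h2
  rcases mul_eq_zero.1 h3 with h4 | h4
  · exact absurd h4 Complex.I_ne_zero
  · linear_combination (1/2 : ℂ) * h1 - (1/2 : ℂ) * h4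

/-- One Gram–Schmidt step on two linearly independent vectors of `L`. -/
lemma exists_orthonormal_pair {L : Submodule ℂ A} (h : 1 < Module.rank ℂ L) :
    ∃ x ∈ L, ∃ y ∈ L, ‖x‖ = 1 ∧ ‖y‖ = 1 ∧ inner ℂ x y = 0 := by
  rw [← not_le, rank_submodule_le_one_iff] at h
  push Not at h
  obtain ⟨x, hxL, hx⟩ := SetLike.not_le_iff_exists.1 (h 0 L.zero_mem)
  have hx0 : x ≠ 0 := by rintro rfl; exact hx (Submodule.zero_mem _)
  set x' : A := (‖x‖⁻¹ : ℂ) • x with hx'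
  have hx1 : ‖x'‖ = 1 := norm_smul_inv_norm hx0
  have hxL' : x' ∈ L := L.smul_mem _ hxL
  obtain ⟨y, hyL, hy⟩ := SetLike.not_le_iff_exists.1 (h x' hxL')
  set z := y - inner ℂ x' y • x' with hz
  have hz0 : z ≠ 0 := fun h0 => hy (Submodule.mem_span_singleton.2 ⟨_, (sub_eq_zero.1 h0).symm⟩)
  have hxz : inner ℂ x' z = 0 := by
    rw [hz, inner_sub_right, inner_smul_right, inner_self_eq_norm_sq_to_K, hx1]
    simp
  refine ⟨x', hxL', (‖z‖⁻¹ : ℂ) • z, L.smul_mem _ (L.sub_mem hyL (L.smul_mem _ hxL')), hx1,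
    norm_smul_inv_norm hz0, ?_⟩
  rw [inner_smul_right, hxz, mul_zero]

lemma supp_ketBra_le {L : Submodule ℂ A} {u : A} (hu : u ∈ L) :
    supp (ketBra u u : A →L[ℂ] A) ≤ L := by
  have h1 : (Submodule.span ℂ {u})ᗮ ≤ LinearMap.ker ((ketBra u u : A →L[ℂ] A) : A →ₗ[ℂ] A) := by
    intro z hz
    have := Submodule.mem_orthogonal_singleton_iff_inner_right.1 hz
    simp [this]
  have h2 := Submodule.orthogonal_le h1
  rw [Submodule.orthogonal_orthogonal] at h2
  exact h2.trans ((Submodule.span_singleton_le_iff_mem _ _).2 hu)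

lemma isNoncommutative_of_quantumCapacity_pos (halg : IsAlgebra (noncommutativeGraph V))
    (h : 0 < quantumCapacity (stinespringChannel V)) :
    IsNoncommutative (commutant (noncommutativeGraph V)) := by
  obtain ⟨L, hL⟩ := lt_iSup_iff.1 h
  obtain ⟨⟨-, Ψ, hΨ, hrec⟩, hL⟩ := lt_iSup_iff.1 hL
  obtain ⟨x, hxL, y, hyL, hx, hy, hxy⟩ :=
    exists_orthonormal_pair (Cardinal.one_lt_toENat.1 (zero_lt_log_iff.1 hL))
  have hrec' : ∀ u ∈ L, ‖u‖ = 1 → Ψ (stinespringChannel V (ketBra u u)) = ketBra u u :=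
    fun u hu hu1 => hrec _ (isState_ketBra hu1) (supp_ketBra_le hu)
  -- Replacing `y` by `i y` in `kraus_norm_eq` makes the imaginary part of `⟨W_e x, W_e y⟩` vanish
  -- as well; polarization then treats different `e` and `f`.
  have hIy : ‖Complex.I • y‖ = 1 := by rw [norm_smul, Complex.norm_I, hy, mul_one]
  have hxIy : inner ℂ x (Complex.I • y) = 0 := by rw [inner_smul_right, hxy, mul_zero]
  have h1 := fun e => kraus_norm_eq V hΨ hrec' hxL hyL hx hy hxy e
  have h2 := fun e => (kraus_norm_eq V hΨ hrec' hxL (L.smul_mem Complex.I hyL) hx hIy hxIy e).2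
  refine isNoncommutative_of_indistinguishable V halg hx (x := x) (y := y) ?_ fun e f => ?_
  · refine sesquilinear_eq_zero (by simp [kraus_add])
      (by simp [kraus_add])
      (fun c e f => by rw [kraus_smul, smul_apply, inner_smul_left, Complex.conj_conj])
      (fun c e f => by rw [kraus_smul, smul_apply, inner_smul_right]) fun e => ?_
    have h3 := h2 e
    rw [map_smul, inner_smul_right] at h3
    refine Complex.ext (h1 e).2 ?_
    simpa using h3
  · refine sub_eq_zero.1 (sesquilinear_eq_zero
      (F := fun e f => inner ℂ (kraus V e x) (kraus V f x) - inner ℂ (kraus V e y) (kraus V f y))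
      (fun _ _ _ => ?_) (fun _ _ _ => ?_) (fun _ _ _ => ?_)
      (fun _ _ _ => ?_) (fun e => ?_) e f)
    · simp only [kraus_add, add_apply, inner_add_left]; ring
    · simp only [kraus_add, add_apply, inner_add_right]; ring
    · simp only [kraus_smul, smul_apply, inner_smul_left, Complex.conj_conj]; ring
    · simp only [kraus_smul, smul_apply, inner_smul_right]; ring
    · rw [inner_self_eq_norm_sq_to_K, inner_self_eq_norm_sq_to_K, (h1 e).1, sub_self]

end Converse
end ZeroError

end

theorem mainTheorem9
    {A : Type*} [NormedAddCommGroup A] [InnerProductSpace ℂ A] [CompleteSpace A]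
    [TopologicalSpace.SeparableSpace A]
    {B : Type*} [NormedAddCommGroup B] [InnerProductSpace ℂ B] [CompleteSpace B]
    [TopologicalSpace.SeparableSpace B]
    {E : Type*} [NormedAddCommGroup E] [InnerProductSpace ℂ E] [CompleteSpace E]
    [TopologicalSpace.SeparableSpace E]
    (Φ : ZeroError.traceClass A →ₗ[ℂ] ZeroError.traceClass B)
    (hΦ : ZeroError.IsQuantumChannel Φ)
    (V : A →ₗᵢ[ℂ] ZeroError.HilbertTensor B E)
    (hV : ZeroError.IsStinespringRepresentation Φ V) :
    (ZeroError.commutant (ZeroError.noncommutativeGraph V) ≠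
        Set.range (fun c : ℂ => c • (1 : A →L[ℂ] A)) →
      0 < ZeroError.classicalCapacity Φ) ∧
    (ZeroError.IsNoncommutative (ZeroError.commutant (ZeroError.noncommutativeGraph V)) →
      0 < ZeroError.quantumCapacity Φ) ∧
    (ZeroError.IsAlgebra (ZeroError.noncommutativeGraph V) →
      (ZeroError.commutant (ZeroError.noncommutativeGraph V) ≠
          Set.range (fun c : ℂ => c • (1 : A →L[ℂ] A)) ↔
        0 < ZeroError.classicalCapacity Φ) ∧
      (ZeroError.IsNoncommutative (ZeroError.commutant (ZeroError.noncommutativeGraph V)) ↔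
        0 < ZeroError.quantumCapacity Φ)) := by
  obtain rfl : Φ = ZeroError.stinespringChannel V := LinearMap.ext hV
  have h1 := ZeroError.classicalCapacity_pos_of_commutant_ne V
  have h2 := ZeroError.quantumCapacity_pos_of_isNoncommutative V hΦ.tracePreserving
  exact ⟨h1, h2, fun halg => ⟨⟨h1, ZeroError.commutant_ne_of_classicalCapacity_pos V halg⟩,
    ⟨h2, ZeroError.isNoncommutative_of_quantumCapacity_pos V halg⟩⟩⟩
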